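/- **Setting.** A polygonal curve $P$ in $\mathbb{R}^d$ with vertices $p_1,\dots,p_n$ ($n\ge 1$) is the piecewise linear map $P:[1,n]\to\mathbb{R}^d$ with $P(t)=p_i+(t-i)(p_{i+1}-p_i)$ for $t\in[i,i+1]$. It is *$c$-packed* if for every $r>0$ the total length of $P$ inside any ball of radius $r$ is at most $cr$. The Fréchet distance of $P$ and $Q$ (with $n$ and $m$ vertices) is $d_F(P,Q)=\min_{(f,g)}\max_{t\in[0,1]}\|P(f(t))-Q(g(t))\|$, where $f:[0,1]\to[1,n]$ and $g:[0,1]\to[1,m]$ range over the non-decreasing surjections. The $\delta$-free space of $P,Q$ is the set of $(x,y)\in[1,n]\times[1,m]$ with $\|P(x)-Q(y)\|\le\delta$; a point of it is reachable if a path that is monotone in both coordinates leads to it from $(1,1)$ inside the free space; a cell $[i,i+1]\times[j,j+1]$ is reachable if it contains a reachable point (a curve with one vertex counts as having one edge of length $0$). The greedy $\mu$-simplification of $P$ is the subsequence of its vertices that starts with $p_1$ and always continues with the first later vertex at distance at least $\mu$ from the last one taken. **FallibleDecider**$(P,Q,\Delta,\varepsilon,c')$. Let $S_P,S_Q$ be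 the greedy $\frac{\varepsilon}{4}\Delta$-simplifications of $P$ and $Q$, and $K=(1+\varepsilon)^2\,(27c'+96c'/\varepsilon)\,(n+m)$. Explore the reachable cells of the $(1+\frac{\varepsilon}{2})\Delta$-free space of $S_P,S_Q$, in the order of the antidiagonals, up to $\lfloor K\rfloor+1$ cells. Report "Yes" if the final corner $(|S_P|,|S_Q|)$ is found to be reachable; otherwise "Timeout" if more than $K$ cells were explored; otherwise "No". **RefineUpperBound**$(P,Q,\Delta^+,\varepsilon)$. Let $\Delta_i=\Delta^+/(1+\varepsilon)^i$ and start with $c'=1$. Repeat: if FallibleDecider$(P,Q,\Delta^+,\varepsilon,c')$ is "Yes", scan $b=0,1,2,\dots$ for the smallest $b$ such that FallibleDecider$(P,Q,\Delta_{2^b},\varepsilon,c')$ is not "Yes"; find by binary search an $i\in\{1,\dots,2^b\}$ such that FallibleDecider is "Yes" for $\Delta_{i-1}$ and not "Yes" for $\Delta_i$; if it is "No" for $\Delta_i$, return $(1+\varepsilon)\Delta_{i-1}$. If nothing was returned, replace $c'$ by $2c'$. Time is the number of steps on a real RAM, where an arithmetic operation, square root or comparison of numbers, a distance, difference or inner product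 of two points of $\mathbb{R}^d$, and an elementary operation on a sequence each count as one step. **Lemma (RefineUpperBound).** There is an absolute constant $C>0$ such that the following holds. Let $P$ and $Q$ be polygonal curves in $\mathbb{R}^d$ with $n$ and $m$ vertices, such that $d_F(P,Q)>0$ and at least one of $P$ and $Q$ is $c$-packed, where $c\ge 1$ is not known to the procedure. Let $\varepsilon\in(0,1]$ and $\Delta^+\ge d_F(P,Q)$. Then RefineUpperBound$(P,Q,\Delta^+,\varepsilon)$ terminates and returns a value $\Delta$ with $$d_F(P,Q)\le\Delta<(1+\varepsilon)^2\,d_F(P,Q),$$ after at most $$C\cdot c\,\frac{n+m}{\varepsilon}\left(1+\log\left(1+\frac1\varepsilon\log\frac{\Delta^+}{d_F(P,Q)}\right)\right)$$ steps. -/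

import Mathlib

namespace Frechet

noncomputable section

/-! ### Polygonal curves, packedness, Fréchet distance -/

/-- Points of `ℝ^d`, with the Euclidean norm. -/
abbrev Pt (d : ℕ) : Type := EuclideanSpace ℝ (Fin d)

/-- A polygonal curve in `ℝ^d`, given by its nonempty sequence of vertices. -/
structure Curve (d : ℕ) where
  verts : List (Pt d)
  ne_nil : verts ≠ []

namespace Curve

variable {d : ℕ}

/-- The number of vertices. -/
def size (P : Curve d) : ℕ := P.verts.length

/-- The vertex with index `i` (indices start at `0`); past the end it is the last vertex. -/
def vertex (P : Curve d) (i : ℕ) : Pt d := P.verts.getD i (P.verts.getLast P.ne_nil)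

/-- The curve as a piecewise linear function on `[0, n - 1]`, where `n` is the number of vertices:
on `[i, i + 1]` it runs linearly from vertex `i` to vertex `i + 1`. -/
def eval (P : Curve d) (t : ℝ) : Pt d :=
  AffineMap.lineMap (P.vertex ⌊t⌋₊) (P.vertex (⌊t⌋₊ + 1)) (t - ⌊t⌋₊)

/-- The total length of the curve inside the closed ball `B(x, r)`: the sum over the edges of the
length of the part of the edge that lies in the ball. -/
def lengthInBall (P : Curve d) (x : Pt d) (r : ℝ) : ℝ :=
  ∑ i ∈ Finset.range (P.size - 1),
    dist (P.vertex i) (P.vertex (i + 1)) *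
      MeasureTheory.volume.real
        {t : ℝ | t ∈ Set.Icc (0 : ℝ) 1 ∧
          AffineMap.lineMap (P.vertex i) (P.vertex (i + 1)) t ∈ Metric.closedBall x r}

/-- `P` is `c`-packed. -/
def IsPacked (P : Curve d) (c : ℝ) : Prop :=
  ∀ (x : Pt d) (r : ℝ), 0 < r → P.lengthInBall x r ≤ c * r

/-- `f` restricts to a non-decreasing surjection from `[0, 1]` onto the domain of `P`. -/
def IsReparam (P : Curve d) (f : ℝ → ℝ) : Prop :=
  MonotoneOn f (Set.Icc 0 1) ∧ f '' Set.Icc 0 1 = Set.Icc 0 ((P.size : ℝ) - 1)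

end Curve

/-- The continuous Fréchet distance: the infimum over all matchings `(f, g)` of the largest
distance between matched points. -/
def frechetDist {d : ℕ} (P Q : Curve d) : ℝ :=
  sInf {δ : ℝ | ∃ f g : ℝ → ℝ, P.IsReparam f ∧ Q.IsReparam g ∧
    δ = sSup ((fun t => dist (P.eval (f t)) (Q.eval (g t))) '' Set.Icc 0 1)}

/-! ### Step counting

Time is counted on a real RAM. A program is a value together with the number of elementary steps
spent on it. One step is charged, through `op`, for each elementary operation: an arithmetic
operation, a square root or a comparison of numbers; a distance, a difference or an inner product
of points of `ℝ^d`; reading an entry of a sequence by its index, appending an entry to a sequence,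
taking the next entry of a sequence; forming or inspecting a record of bounded size. Adding `1` or
`2` to an index is part of the operation that uses the index. Branching on a computed Boolean and
passing on a computed value are free. -/

/-- A value together with the number of steps spent on computing it. -/
structure Timed (α : Type) where
  val : α
  steps : ℕ

instance : Monad Timed where
  pure a := ⟨a, 0⟩
  bind x f := ⟨(f x.val).val, x.steps + (f x.val).steps⟩

/-- One elementary operation with result `a`. -/
def op {α : Type} (a : α) : Timed α := ⟨a, 1⟩

/-! ### Greedy simplification -/

/-- The vertices that the greedy `μ`-simplification takes from the remaining vertices, if the last
vertex that it has taken is `s`: always the first one at distance at least `μ` from the last one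
taken. -/
def simplifyFrom {d : ℕ} (μ : ℝ) : Pt d → List (Pt d) → Timed (List (Pt d))
  | _, [] => op []
  | s, q :: qs => do
    let q ← op q
    let r ← op (dist s q)
    let far ← op (decide (μ ≤ r))
    if far then do
      let rest ← simplifyFrom μ q qs
      op (q :: rest)
    else
      simplifyFrom μ s qs

/-- The greedy `μ`-simplification of `P`; it starts with the first vertex of `P`. -/
def simplify {d : ℕ} (μ : ℝ) (P : Curve d) : Timed (Curve d) := do
  let s ← op (P.verts.head P.ne_nil)
  let rest ← simplifyFrom μ s P.verts.tail
  op ⟨s :: rest, List.cons_ne_nil s rest⟩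

/-! ### Exploring the reachable cells of the free space -/

/-- The interval of all `t ∈ [0, 1]` for which the point `a + t (b - a)` has distance at most `δ`
from `s` (for `δ ≥ 0`), found by solving a quadratic equation; `none` if there is no such `t`. -/
def freeInterval {d : ℕ} (δ : ℝ) (s a b : Pt d) : Timed (Option (ℝ × ℝ)) := do
  let u ← op (b - a)
  let w ← op (a - s)
  let A ← op (inner ℝ u u)
  let B ← op (inner ℝ u w)
  let W ← op (inner ℝ w w)
  let δ2 ← op (δ * δ)
  let C ← op (W - δ2)
  let degenerate ← op (decide (A = 0))
  if degenerate then do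
    let free ← op (decide (C ≤ 0))
    if free then op (some (0, 1)) else op none
  else do
    let B2 ← op (B * B)
    let AC ← op (A * C)
    let D ← op (B2 - AC)
    let noRoot ← op (decide (D < 0))
    if noRoot then op none
    else do
      let r ← op (Real.sqrt D)
      let B' ← op (-B)
      let x ← op (B' - r)
      let y ← op (B' + r)
      let x ← op (x / A)
      let y ← op (y / A)
      let lo ← op (max 0 x)
      let hi ← op (min 1 y)
      let nonempty ← op (decide (lo ≤ hi))
      if nonempty then op (some (lo, hi)) else op none

/-- The lowest point of the reachable part of a side of a cell whose free interval is `I`.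
`opposite` and `adjacent` are the lowest reachable points of the parallel and of the other entry
side of the cell, if there are any. From a reachable point of the other entry side all of `I` can
be reached; otherwise, from the lowest reachable point `l` of the parallel side, the part of `I`
above `l`. -/
def exitSide (I : Option (ℝ × ℝ)) (opposite adjacent : Option ℝ) : Timed (Option ℝ) := do
  let I ← op I
  match I with
  | none => op none
  | some (lo, hi) => do
    let adjacent ← op adjacent
    match adjacent with
    | some _ => op (some lo)
    | none => do
      let opposite ← op opposite
      match opposite with
      | none => op none
      | some l => do
        let x ← op (max lo l)
        let nonempty ← op (decide (x ≤ hi))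
        if nonempty then op (some x) else op none

/-- A record for the cell `[i, i + 1] × [j, j + 1]`: the lowest reachable points, in coordinates
relative to the cell, that are known on its left and on its bottom side, if there are any. -/
structure Entry where
  i : ℕ
  j : ℕ
  left : Option ℝ
  bottom : Option ℝ

/-- Takes the cell of the first record `e` of the queue `e :: q`, joining `e` with the record that
follows it if that one belongs to the same cell. -/
def popCell (e : Entry) : List Entry → Timed (Entry × List Entry)
  | [] => op (e, [])
  | e' :: q => do
    let same ← op (decide (e.i = e'.i))
    let same' ← op (decide (e.j = e'.j))
    if same && same' then
      op (⟨e.i, e.j, e.left.or e'.left, e.bottom.or e'.bottom⟩, q)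
    else
      op (e, e' :: q)

/-- Appends the record `f x` at the end of the queue, if `lo` is `some x`. -/
def enqueue (q : List Entry) (lo : Option ℝ) (f : ℝ → Entry) : Timed (List Entry) :=
  match lo with
  | none => op q
  | some x => op (q ++ [f x])

/-- The possible reports of the fallible decider. -/
inductive Answer
  | yes
  | no
  | timeout

/-- Explores the reachable cells of the `δ`-free space of `S` and `T`, in the order of the queue,
which goes through the antidiagonals `i + j = 0, 1, 2, …` one after the other, each by increasing
`i`. At most as many cells are explored as the first number says: the report is "yes" as soon as
the final corner of the parameter space is found to be reachable, "timeout" if that many cells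
have been explored before this, and "no" if the reachable cells are exhausted earlier.
A curve with one vertex counts as having one edge, of length `0`, so that the parameter space
always has a cell. -/
def explore {d : ℕ} (S T : Curve d) (δ : ℝ) : ℕ → List Entry → Timed Answer
  | 0, _ => op Answer.timeout
  | _ + 1, [] => op Answer.no
  | k + 1, e :: q => do
    let (e, q) ← popCell e q
    let p₀ ← op (S.vertex e.i)
    let p₁ ← op (S.vertex (e.i + 1))
    let q₀ ← op (T.vertex e.j)
    let q₁ ← op (T.vertex (e.j + 1))
    let hasRight ← op (decide (e.i + 2 < S.size))
    let hasTop ← op (decide (e.j + 2 < T.size))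
    if !hasRight && !hasTop then do
      let r ← op (dist p₁ q₁)
      let free ← op (decide (r ≤ δ))
      if free then op Answer.yes else explore S T δ k q
    else do
      let top ← if hasTop then do
          let I ← freeInterval δ q₁ p₀ p₁
          exitSide I e.bottom e.left
        else op none
      let right ← if hasRight then do
          let I ← freeInterval δ p₁ q₀ q₁
          exitSide I e.left e.bottom
        else op none
      let q ← enqueue q top (fun x => ⟨e.i, e.j + 1, none, some x⟩)
      let q ← enqueue q right (fun y => ⟨e.i + 1, e.j, some y, none⟩)
      explore S T δ k q

/-- The queue that the exploration starts with: the cell at the corner `(0, 0)`, if this corner is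
free. -/
def startQueue {d : ℕ} (S T : Curve d) (δ : ℝ) : Timed (List Entry) := do
  let p ← op (S.vertex 0)
  let q ← op (T.vertex 0)
  let r ← op (dist p q)
  let free ← op (decide (r ≤ δ))
  if free then op [⟨0, 0, some 0, some 0⟩] else op []

/-- The least positive integer that exceeds `K` (for `K ≥ 0`), found by counting `1, 2, 3, …` with
one increment and one comparison each, since rounding is not an elementary operation. -/
def countBeyond (K : ℝ) : Timed ℕ := ⟨⌊K⌋₊ + 1, 2 * (⌊K⌋₊ + 1)⟩

/-- `FallibleDecider(P, Q, Δ, ε, c)`: explores at most `⌊K⌋ + 1` reachable cells of the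
`(1 + ε/2)Δ`-free space of the greedy `(ε/4)Δ`-simplifications, where
`K = (1 + ε)² (27 c + 96 c / ε) (n + m)`. -/
def fallibleDecider {d : ℕ} (P Q : Curve d) (Δ ε c : ℝ) : Timed Answer := do
  let ε4 ← op (ε / 4)
  let μ ← op (ε4 * Δ)
  let S ← simplify μ P
  let T ← simplify μ Q
  let ε1 ← op (1 + ε)
  let ε1sq ← op (ε1 * ε1)
  let a ← op (27 * c)
  let b ← op (96 * c)
  let b ← op (b / ε)
  let ab ← op (a + b)
  let N ← op ((P.size + Q.size : ℕ) : ℝ)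
  let K ← op (ε1sq * ab)
  let K ← op (K * N)
  let ε2 ← op (ε / 2)
  let ε2 ← op (1 + ε2)
  let δ ← op (ε2 * Δ)
  let q ← startQueue S T δ
  let budget ← countBeyond K
  explore S T δ budget q

/-! ### The search procedure

Write `Δ_i = Δ⁺ / (1 + ε)^i`. -/

/-- The linear scan for the smallest `b` such that the fallible decider does not report "yes" for
`Δ_(2^b)`. In the round for `b` the number `r` is `(1 + ε)^(2^b)`, and `pows` lists
`(1 + ε)^(2^k)` for `k = b - 1, …, 0`; the scan returns the list `pows` for the `b` it finds. The
first argument bounds the number of rounds; if it is used up, the result is `none`. -/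
def scan {d : ℕ} (P Q : Curve d) (Δup ε c : ℝ) :
    ℕ → (r : ℝ) → (pows : List ℝ) → Timed (Option (List ℝ))
  | 0, _, _ => pure none
  | k + 1, r, pows => do
    let Δ ← op (Δup / r)
    let a ← fallibleDecider P Q Δ ε c
    let a ← op a
    match a with
    | Answer.yes => do
      let r2 ← op (r * r)
      let pows ← op (r :: pows)
      scan P Q Δup ε c k r2 pows
    | _ => op (some pows)

/-- The binary search for an `i` such that the decider reports "yes" for `Δ_(i-1)` but not for
`Δ_i`; it returns `Δ_(i-1)`. The search interval is `(l, l + 2^k]`, `k` being the length of the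
list, which holds `(1 + ε)^(2^(k-1)), …, (1 + ε)^(2^0)`, and `Δlo` is `Δ_l`; the value that is
probed is the one at the middle of the interval. -/
def binarySearch {d : ℕ} (P Q : Curve d) (ε c : ℝ) : (Δlo : ℝ) → List ℝ → Timed ℝ
  | Δlo, [] => op Δlo
  | Δlo, r :: rs => do
    let Δmid ← op (Δlo / r)
    let a ← fallibleDecider P Q Δmid ε c
    let a ← op a
    match a with
    | Answer.yes => binarySearch P Q ε c Δmid rs
    | _ => binarySearch P Q ε c Δlo rs

/-- One round of `RefineUpperBound`, for one estimate `c` of the packedness. The result is `none`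
if the bound `fuel` on the rounds of the scan is used up, `some none` if the round ends without an
answer, so that the estimate `c` has to be doubled, and `some (some Δ)` if `Δ` is returned. -/
def refineRound {d : ℕ} (fuel : ℕ) (P Q : Curve d) (Δup ε c : ℝ) :
    Timed (Option (Option ℝ)) := do
  let a ← fallibleDecider P Q Δup ε c
  let a ← op a
  match a with
  | Answer.yes => do
    let ε1 ← op (1 + ε)
    let pows ← scan P Q Δup ε c fuel ε1 []
    match pows with
    | none => pure none
    | some pows => do
      let Δlo ← binarySearch P Q ε c Δup pows
      let Δhi ← op (Δlo / ε1)
      let a ← fallibleDecider P Q Δhi ε c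
      let a ← op a
      match a with
      | Answer.no => do
        let Δ ← op (ε1 * Δlo)
        op (some (some Δ))
      | _ => op (some none)
  | _ => op (some none)

/-- The main loop of `RefineUpperBound`, from the estimate `c` on. -/
def refineLoop {d : ℕ} (fuel : ℕ) (P Q : Curve d) (Δup ε : ℝ) : ℕ → ℝ → Timed (Option ℝ)
  | 0, _ => pure none
  | k + 1, c => do
    let res ← refineRound fuel P Q Δup ε c
    match res with
    | none => pure none
    | some (some Δ) => op (some Δ)
    | some none => do
      let c2 ← op (2 * c)
      refineLoop fuel P Q Δup ε k c2

/-- `RefineUpperBound(P, Q, Δ⁺, ε)`, where each of the two loops without an a priori bound (the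
doubling of the estimate of the packedness, which starts at `1`, and the linear scan) is cut off
after `fuel` rounds, with the result `none`. -/
def refineUpperBound {d : ℕ} (fuel : ℕ) (P Q : Curve d) (Δup ε : ℝ) : Timed (Option ℝ) :=
  refineLoop fuel P Q Δup ε fuel 1

/-- The procedure `RefineUpperBound`, run on `(P, Q, Δ⁺, ε)` without any cut-off, terminates after
`time` steps and returns `Δ`. -/
def RefineUpperBoundReturns {d : ℕ} (P Q : Curve d) (Δup ε Δ : ℝ) (time : ℕ) : Prop :=
  ∃ N : ℕ, ∀ fuel : ℕ, N ≤ fuel → refineUpperBound fuel P Q Δup ε = ⟨some Δ, time⟩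

end

end Frechet

/-! The simplifications move a curve by less than `(ε/4)Δ`, so "yes" at `Δ` certifies
`d_F(P, Q) ≤ (1 + ε)Δ` and "no" certifies `Δ < d_F(P, Q)`. Hence neighbours `Δ`, `Δ / (1 + ε)` of
the geometric sequence with reports "yes" and "no" enclose the distance in a factor `(1 + ε)²`.

"Timeout" is excluded once the estimate is at least the packedness. Suppose that `P` is packed with
simplification `S`, and consider a reachable cell formed by an edge of `S` and an edge of `T`.
Either the edge of `S` comes near the first vertex of the edge of `T`; as the edges of `S` have
length at least `(ε/4)Δ` and each is charged to a nearby piece of `P` of comparable length,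
packedness bounds the number of such cells in a row. Or the edge of `T` is long, and the part of `P`
that a monotone path matches with it crosses an annulus around the first vertex of the edge of `S`;
these parts are disjoint for different edges of `T`, so packedness bounds the number of such cells
in a column.

For the running time, the estimates form a geometric series with last term at most `2c`, and the
exponential scan followed by a binary search makes at most logarithmically many calls per estimate,
since "yes" at `Δ` bounds `Δ` from below by `d_F(P, Q) / (1 + ε)`. -/

namespace Frechet

open Set MeasureTheory

/-! ### Piecewise linear interpolation -/

section Interpolation

variable {E : Type*} [SeminormedAddCommGroup E] [NormedSpace ℝ E]

lemma dist_lineMap_lineMap_le {a b a' b' : E} {D t : ℝ} (ha : dist a a' ≤ D) (hb : dist b b' ≤ D)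
    (ht : t ∈ Icc (0 : ℝ) 1) :
    dist (AffineMap.lineMap a b t) (AffineMap.lineMap a' b' t) ≤ D := by
  have hmem := (convex_closedBall (0 : E) D).lineMap_mem (x := a - a') (y := b - b')
    (by simpa [dist_eq_norm] using ha) (by simpa [dist_eq_norm] using hb) ht
  rw [mem_closedBall_zero_iff] at hmem
  rw [dist_eq_norm]
  refine (le_of_eq (congrArg _ ?_)).trans hmem
  simp only [AffineMap.lineMap_apply_module]
  module

/-- The piecewise linear interpolation of the values `v k` at the natural numbers `k`. Both the
parametrization of a polygonal curve and the maps between parameter domains are of this form. -/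
noncomputable def interp (v : ℕ → E) (t : ℝ) : E :=
  AffineMap.lineMap (v ⌊t⌋₊) (v (⌊t⌋₊ + 1)) (t - ⌊t⌋₊)

lemma interp_eq_lineMap (v : ℕ → E) {k : ℕ} {t : ℝ} (ht : t ∈ Icc (k : ℝ) (k + 1)) :
    interp v t = AffineMap.lineMap (v k) (v (k + 1)) (t - k) := by
  rcases ht.2.lt_or_eq with hlt | heq
  · rw [interp, (Nat.floor_eq_iff (k.cast_nonneg.trans ht.1)).mpr ⟨ht.1, hlt⟩]
  · have hfloor : ⌊t⌋₊ = k + 1 := by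
      rw [heq]; exact_mod_cast Nat.floor_natCast (R := ℝ) (k + 1)
    rw [interp, hfloor, heq]
    simp

lemma interp_natCast (v : ℕ → E) (k : ℕ) : interp v k = v k := by
  simp [interp]

lemma mem_Icc_floor {t : ℝ} (ht : 0 ≤ t) : t ∈ Icc (⌊t⌋₊ : ℝ) (⌊t⌋₊ + 1) :=
  ⟨Nat.floor_le ht, (Nat.lt_floor_add_one t).le⟩

lemma sub_mem_unitInterval {k : ℕ} {t : ℝ} (ht : t ∈ Icc (k : ℝ) (k + 1)) :
    t - k ∈ Icc (0 : ℝ) 1 :=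
  ⟨sub_nonneg.mpr ht.1, by linarith [ht.2]⟩

lemma dist_interp_le {v w : ℕ → E} {D t : ℝ} (h : ∀ k, dist (v k) (w k) ≤ D) (ht : 0 ≤ t) :
    dist (interp v t) (interp w t) ≤ D :=
  dist_lineMap_lineMap_le (h _) (h _) (sub_mem_unitInterval (mem_Icc_floor ht))

lemma interp_mem_convexHull (v : ℕ → E) {t : ℝ} (ht : 0 ≤ t) :
    interp v t ∈ convexHull ℝ (range v) :=
  (convex_convexHull ℝ _).lineMap_mem (subset_convexHull ℝ _ (mem_range_self _))
    (subset_convexHull ℝ _ (mem_range_self _)) (sub_mem_unitInterval (mem_Icc_floor ht))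

lemma interp_interp {ρ : ℕ → ℕ} (hρ : ∀ k, ρ (k + 1) = ρ k ∨ ρ (k + 1) = ρ k + 1) (w : ℕ → E)
    {t : ℝ} (ht : 0 ≤ t) :
    interp w (interp (fun k => (ρ k : ℝ)) t) = interp (fun k => w (ρ k)) t := by
  have hmem := mem_Icc_floor ht
  have hunit := sub_mem_unitInterval hmem
  rw [interp_eq_lineMap _ hmem, interp_eq_lineMap _ hmem]
  rcases hρ ⌊t⌋₊ with hstay | hstep
  · rw [hstay, AffineMap.lineMap_same_apply, AffineMap.lineMap_same_apply, interp_natCast]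
  · have hval : AffineMap.lineMap (ρ ⌊t⌋₊ : ℝ) ((ρ ⌊t⌋₊ + 1 : ℕ) : ℝ) (t - ⌊t⌋₊) =
        ρ ⌊t⌋₊ + (t - ⌊t⌋₊) := by
      rw [AffineMap.lineMap_apply_ring']
      push_cast
      ring
    rw [hstep, hval, interp_eq_lineMap w (k := ρ ⌊t⌋₊)
      ⟨by linarith [hunit.1], by linarith [hunit.2]⟩, add_sub_cancel_left]

lemma continuousOn_interp (v : ℕ → E) (n : ℕ) : ContinuousOn (interp v) (Icc 0 n) := by
  induction n with
  | zero => simp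
  | succ n ih =>
    have hlast : ContinuousOn (interp v) (Icc (n : ℝ) (n + 1)) :=
      ((AffineMap.lineMap_continuous (p := v n) (q := v (n + 1)) (R := ℝ)).comp
        (continuous_sub_right (n : ℝ))).continuousOn.congr fun t ht => interp_eq_lineMap v ht
    rw [Nat.cast_succ, ← Icc_union_Icc_eq_Icc n.cast_nonneg (by linarith : (n : ℝ) ≤ n + 1)]
    exact ih.union_of_isClosed hlast isClosed_Icc isClosed_Icc

end Interpolation

lemma monotoneOn_Ici_of_unit_steps {f : ℝ → ℝ} (h : ∀ k : ℕ, MonotoneOn f (Icc (k : ℝ) (k + 1))) :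
    MonotoneOn f (Ici 0) := by
  have hIcc : ∀ n : ℕ, MonotoneOn f (Icc 0 (n : ℝ)) := fun n => by
    induction n with
    | zero => simp
    | succ n ih =>
      have hn : (n : ℝ) ≤ n + 1 := by linarith
      rw [Nat.cast_succ, ← Icc_union_Icc_eq_Icc n.cast_nonneg hn]
      exact ih.union_right (h n) (isGreatest_Icc n.cast_nonneg) (isLeast_Icc hn)
  intro x hx y hy hxy
  obtain ⟨n, hn⟩ := exists_nat_ge y
  exact hIcc n ⟨hx, hxy.trans hn⟩ ⟨hy, hn⟩ hxy

lemma monotoneOn_interp {u : ℕ → ℝ} (hu : Monotone u) : MonotoneOn (interp u) (Ici 0) := by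
  refine monotoneOn_Ici_of_unit_steps fun k x hx y hy hxy => ?_
  rw [interp_eq_lineMap u hx, interp_eq_lineMap u hy, AffineMap.lineMap_apply_ring',
    AffineMap.lineMap_apply_ring']
  have := sub_nonneg.mpr (hu k.le_succ)
  gcongr

/-! ### Polygonal curves -/

namespace Curve

variable {d : ℕ} (P : Curve d)

lemma size_pos : 0 < P.size :=
  List.length_pos_iff.mpr P.ne_nil

lemma size_sub_one_nonneg : 0 ≤ (P.size : ℝ) - 1 :=
  sub_nonneg.mpr (by exact_mod_cast P.size_pos)

lemma cast_size_sub_one : ((P.size - 1 : ℕ) : ℝ) = P.size - 1 := by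
  rw [Nat.cast_sub P.size_pos, Nat.cast_one]

lemma vertex_mem (i : ℕ) : P.vertex i ∈ P.verts := by
  rw [vertex]
  rcases lt_or_ge i P.verts.length with hi | hi
  · rw [List.getD_eq_getElem _ _ hi]
    exact List.getElem_mem hi
  · rw [List.getD_eq_default _ _ hi]
    exact List.getLast_mem P.ne_nil

lemma vertex_of_size_le {i : ℕ} (h : P.size ≤ i + 1) :
    P.vertex i = P.verts.getLast P.ne_nil := by
  rw [vertex]
  rcases lt_or_ge i P.verts.length with hi | hi
  · obtain rfl : i = P.verts.length - 1 := Nat.eq_sub_of_add_eq (le_antisymm hi h)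
    rw [List.getD_eq_getElem _ _ hi, List.getLast_eq_getElem]
  · rw [List.getD_eq_default _ _ hi]

lemma eval_eq_lineMap {i : ℕ} {x : ℝ} (hx : x ∈ Icc (i : ℝ) (i + 1)) :
    P.eval x = AffineMap.lineMap (P.vertex i) (P.vertex (i + 1)) (x - i) :=
  interp_eq_lineMap P.vertex hx

lemma eval_natCast (i : ℕ) : P.eval i = P.vertex i :=
  interp_natCast P.vertex i

lemma eval_of_size_le {x : ℝ} (h : (P.size : ℝ) - 1 ≤ x) :
    P.eval x = P.verts.getLast P.ne_nil := by
  have hfloor : P.size ≤ ⌊x⌋₊ + 1 := by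
    rw [← Nat.sub_le_iff_le_add]
    exact Nat.le_floor (P.cast_size_sub_one.trans_le h)
  rw [eval, P.vertex_of_size_le hfloor, P.vertex_of_size_le (hfloor.trans (Nat.le_succ _)),
    AffineMap.lineMap_same_apply]

lemma eval_min_size (x : ℝ) : P.eval (min x (P.size - 1)) = P.eval x := by
  rcases le_total x ((P.size : ℝ) - 1) with h | h
  · rw [min_eq_left h]
  · rw [min_eq_right h, P.eval_of_size_le le_rfl, P.eval_of_size_le h]

lemma isBounded_image_eval : Bornology.IsBounded (P.eval '' Ici 0) := by
  have hverts : Bornology.IsBounded (range P.vertex) :=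
    (P.verts.finite_toSet.subset (range_subset_iff.mpr P.vertex_mem)).isBounded
  refine (isBounded_convexHull.mpr hverts).subset ?_
  rintro _ ⟨x, hx, rfl⟩
  exact interp_mem_convexHull P.vertex hx

end Curve

/-! ### Monotone surjections between intervals -/

/-- `f` restricts to a non-decreasing surjection from `[0, a]` onto `[0, b]`; this is
`Curve.IsReparam` for arbitrary intervals. -/
def MonoOnto (f : ℝ → ℝ) (a b : ℝ) : Prop :=
  MonotoneOn f (Icc 0 a) ∧ f '' Icc 0 a = Icc 0 b

namespace MonoOnto

variable {f g : ℝ → ℝ} {a b c : ℝ}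

lemma mapsTo (h : MonoOnto f a b) : MapsTo f (Icc 0 a) (Icc 0 b) :=
  mapsTo_iff_image_subset.mpr h.2.subset

lemma surjOn (h : MonoOnto f a b) : SurjOn f (Icc 0 a) (Icc 0 b) :=
  h.2.superset

lemma comp (hg : MonoOnto g b c) (hf : MonoOnto f a b) : MonoOnto (g ∘ f) a c :=
  ⟨hg.1.comp hf.1 hf.mapsTo, by rw [image_comp, hf.2, hg.2]⟩

lemma nonneg_left (h : MonoOnto f a b) (hb : 0 ≤ b) : 0 ≤ a :=
  let ⟨_, hx, _⟩ := h.surjOn (left_mem_Icc.mpr hb)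
  hx.1.trans hx.2

lemma nonneg_right (h : MonoOnto f a b) (ha : 0 ≤ a) : 0 ≤ b :=
  let hx := h.mapsTo (left_mem_Icc.mpr ha)
  hx.1.trans hx.2

lemma continuousOn (h : MonoOnto f a b) (hb : 0 ≤ b) : ContinuousOn f (Icc 0 a) := by
  have : Nonempty (Icc 0 b) := ⟨⟨0, left_mem_Icc.mpr hb⟩⟩
  have hmono : Monotone (h.mapsTo.restrict f (Icc 0 a) (Icc 0 b)) := fun x y hxy =>
    h.1 x.2 y.2 hxy
  have hsurj := (MapsTo.restrict_surjective_iff h.mapsTo).mpr h.surjOn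
  exact continuousOn_iff_continuous_domRestrict.mpr
    (continuous_subtype_val.comp (hmono.continuous_of_surjective hsurj))

lemma map_zero (h : MonoOnto f a b) (hb : 0 ≤ b) : f 0 = 0 := by
  obtain ⟨x, hx, hx0⟩ := h.surjOn (left_mem_Icc.mpr hb)
  have h0 : (0 : ℝ) ∈ Icc 0 a := ⟨le_rfl, hx.1.trans hx.2⟩
  exact le_antisymm (hx0 ▸ h.1 h0 hx hx.1) (h.mapsTo h0).1

lemma map_right (h : MonoOnto f a b) (hb : 0 ≤ b) : f a = b := by
  obtain ⟨x, hx, hxb⟩ := h.surjOn (right_mem_Icc.mpr hb)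
  have ha : a ∈ Icc 0 a := ⟨hx.1.trans hx.2, le_rfl⟩
  exact le_antisymm (h.mapsTo ha).2 (hxb ▸ h.1 hx ha hx.2)

lemma of_continuousOn (ha : 0 ≤ a) (hmono : MonotoneOn f (Icc 0 a))
    (hcont : ContinuousOn f (Icc 0 a)) (h0 : f 0 = 0) : MonoOnto f a (f a) := by
  refine ⟨hmono, Subset.antisymm ?_ ?_⟩
  · rintro _ ⟨x, hx, rfl⟩
    exact ⟨h0 ▸ hmono (left_mem_Icc.mpr ha) hx hx.1, hmono hx (right_mem_Icc.mpr ha) hx.2⟩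
  · have := intermediate_value_Icc ha hcont
    rwa [h0] at this

lemma restrict (h : MonoOnto f a b) (hc : c ∈ Icc 0 a) : MonoOnto f c (f c) :=
  have hsub : Icc 0 c ⊆ Icc 0 a := Icc_subset_Icc_right hc.2
  have hb := h.nonneg_right (hc.1.trans hc.2)
  of_continuousOn hc.1 (h.1.mono hsub) ((h.continuousOn hb).mono hsub) (h.map_zero hb)

lemma mul_left (ha : 0 ≤ a) : MonoOnto (fun x => a * x) 1 a := by
  simpa only [mul_one] using of_continuousOn (f := fun x => a * x) zero_le_one
    (fun _ _ _ _ h => mul_le_mul_of_nonneg_left h ha) (by fun_prop) (mul_zero a)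

lemma min_right (ha : 0 ≤ a) (hab : a ≤ b) : MonoOnto (fun x => min x a) b a := by
  simpa only [min_eq_right hab] using of_continuousOn (f := fun x => min x a) (ha.trans hab)
    (fun _ _ _ _ h => min_le_min_right a h) (by fun_prop) (min_eq_left ha)

lemma interp {u : ℕ → ℝ} (hu : Monotone u) (h0 : u 0 = 0) (n : ℕ) :
    MonoOnto (interp u) n (u n) := by
  rw [← interp_natCast u n]
  refine of_continuousOn n.cast_nonneg ((monotoneOn_interp hu).mono Icc_subset_Ici_self)
    (continuousOn_interp u n) ?_
  rw [← Nat.cast_zero, interp_natCast, h0, Nat.cast_zero]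

/-- The points `(x, s - x)` of `[0, a] × [0, c]` on the antidiagonal `s` at which `f` and `g`
agree, given by their first coordinates. -/
def agreement (f g : ℝ → ℝ) (a c s : ℝ) : Set ℝ :=
  {x | x ∈ Icc 0 a ∧ s - x ∈ Icc 0 c ∧ f x = g (s - x)}

lemma mem_Icc_max_min {s x : ℝ} :
    x ∈ Icc (max 0 (s - c)) (min a s) ↔ x ∈ Icc 0 a ∧ s - x ∈ Icc 0 c := by
  grind

lemma agreement_nonempty (hb : 0 ≤ b) (hf : MonoOnto f a b) (hg : MonoOnto g c b) {s : ℝ}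
    (hs : s ∈ Icc 0 (a + c)) : (agreement f g a c s).Nonempty := by
  have ha := hf.nonneg_left hb
  have hc := hg.nonneg_left hb
  have hle : max 0 (s - c) ≤ min a s := by grind
  have hdom := fun x => (mem_Icc_max_min (a := a) (c := c) (s := s) (x := x)).mp
  have hlow := hdom _ (left_mem_Icc.mpr hle)
  have hhigh := hdom _ (right_mem_Icc.mpr hle)
  have hf_cont := (hf.continuousOn hb).mono fun x hx => (hdom x hx).1
  have hg_cont : ContinuousOn (fun x => g (s - x)) (Icc (max 0 (s - c)) (min a s)) :=
    (hg.continuousOn hb).comp (by fun_prop) fun x hx => (hdom x hx).2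
  obtain ⟨x, hx, hfg⟩ := isPreconnected_Icc.intermediate_value₂ (left_mem_Icc.mpr hle)
    (right_mem_Icc.mpr hle) hf_cont hg_cont
    (by
      rcases le_total 0 (s - c) with h | h
      · rw [max_eq_right h] at hlow ⊢
        rw [sub_sub_cancel, hg.map_right hb]
        exact (hf.mapsTo hlow.1).2
      · rw [max_eq_left h] at hlow ⊢
        rw [hf.map_zero hb]
        exact (hg.mapsTo hlow.2).1)
    (by
      rcases le_total a s with h | h
      · rw [min_eq_left h] at hhigh ⊢
        rw [hf.map_right hb]
        exact (hg.mapsTo hhigh.2).2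
      · rw [min_eq_right h] at hhigh ⊢
        rw [sub_self, hg.map_zero hb]
        exact (hf.mapsTo hhigh.1).1)
  exact ⟨x, (hdom x hx).1, (hdom x hx).2, hfg⟩

lemma exists_isGreatest_agreement (hb : 0 ≤ b) (hf : MonoOnto f a b) (hg : MonoOnto g c b) {s : ℝ}
    (hs : s ∈ Icc 0 (a + c)) : ∃ x, IsGreatest (agreement f g a c s) x := by
  refine IsCompact.exists_isGreatest ?_ (agreement_nonempty hb hf hg hs)
  have hcont : ContinuousOn (fun x => f x - g (s - x)) (Icc (max 0 (s - c)) (min a s)) :=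
    ((hf.continuousOn hb).mono fun x hx => (mem_Icc_max_min.mp hx).1).sub
      ((hg.continuousOn hb).comp (by fun_prop) fun x hx => (mem_Icc_max_min.mp hx).2)
  have hclosed := hcont.preimage_isClosed_of_isClosed isClosed_Icc (isClosed_singleton (x := 0))
  convert isCompact_Icc.of_isClosed_subset hclosed inter_subset_left using 1
  ext x
  simp only [agreement, mem_ofPred_eq, mem_inter_iff, mem_Icc_max_min, mem_preimage,
    mem_singleton_iff, sub_eq_zero, and_assoc]

lemma isGreatest_agreement_mono (hf : MonotoneOn f (Icc 0 a)) (hg : MonotoneOn g (Icc 0 c))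
    {s s' x x' : ℝ} (hss : s ≤ s') (hx : IsGreatest (agreement f g a c s) x)
    (hx' : IsGreatest (agreement f g a c s') x') : x ≤ x' ∧ s - x ≤ s' - x' := by
  obtain ⟨⟨hxa, hxc, hfg⟩, hmax⟩ := hx
  obtain ⟨⟨hxa', hxc', hfg'⟩, hmax'⟩ := hx'
  constructor
  · by_contra! hlt
    have hmem : s' - x ∈ Icc 0 c := ⟨by linarith [hxc.1], by linarith [hxc'.2]⟩
    have h₁ := hf hxa' hxa hlt.le
    have h₂ := hg hxc hmem (by linarith)
    have h₃ := hg hmem hxc' (by linarith)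
    exact hlt.not_ge (hmax' ⟨hxa, hmem, by linarith⟩)
  · by_contra! hlt
    have hmem : s - (s' - x') ∈ Icc 0 a := ⟨by linarith [hxa.1], by linarith [hxa'.2]⟩
    have h₁ := hg hxc' hxc hlt.le
    have h₂ := hf hxa hmem (by linarith)
    have h₃ := hf hmem hxa' (by linarith)
    have := hmax ⟨hmem, by rwa [sub_sub_cancel], by rw [sub_sub_cancel]; linarith⟩
    linarith

lemma continuousOn_of_monotoneOn_sub {X : ℝ → ℝ} {s : Set ℝ} (hX : MonotoneOn X s)
    (hsub : MonotoneOn (fun t => t - X t) s) : ContinuousOn X s := by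
  refine (LipschitzOnWith.of_le_add fun x hx y hy => ?_).continuousOn
  rcases le_total x y with h | h
  · exact (hX hx hy h).trans (le_add_of_nonneg_right dist_nonneg)
  · have := hsub hy hx h
    rw [Real.dist_eq, abs_of_nonneg (sub_nonneg.mpr h)]
    linarith

/-- The set `{f x = g y}` need not be a monotone path, because it contains a rectangle where both
maps are constant; the point with the greatest `x` on each antidiagonal runs along the lower right
boundary of this set. -/
theorem exists_common_refinement (hb : 0 ≤ b) (hf : MonoOnto f a b) (hg : MonoOnto g c b) :
    ∃ X Y : ℝ → ℝ, MonoOnto X (a + c) a ∧ MonoOnto Y (a + c) c ∧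
      ∀ s ∈ Icc 0 (a + c), f (X s) = g (Y s) := by
  have hac : 0 ≤ a + c := add_nonneg (hf.nonneg_left hb) (hg.nonneg_left hb)
  choose! X hX using fun s (hs : s ∈ Icc 0 (a + c)) => exists_isGreatest_agreement hb hf hg hs
  have hmono := fun s hs s' hs' (hss : s ≤ s') =>
    isGreatest_agreement_mono hf.1 hg.1 hss (hX s hs) (hX s' hs')
  have hX_mono : MonotoneOn X (Icc 0 (a + c)) := fun s hs s' hs' hss => (hmono s hs s' hs' hss).1
  have hY_mono : MonotoneOn (fun s => s - X s) (Icc 0 (a + c)) := fun s hs s' hs' hss =>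
    (hmono s hs s' hs' hss).2
  have hX_cont := continuousOn_of_monotoneOn_sub hX_mono hY_mono
  obtain ⟨⟨hxa₀, hxc₀, -⟩, -⟩ := hX 0 (left_mem_Icc.mpr hac)
  obtain ⟨⟨hxa, hxc, -⟩, -⟩ := hX (a + c) (right_mem_Icc.mpr hac)
  have hX_zero : X 0 = 0 := le_antisymm (by linarith [hxc₀.1]) hxa₀.1
  have hX_right : X (a + c) = a := le_antisymm hxa.2 (by linarith [hxc.2])
  refine ⟨X, fun s => s - X s, ?_, ?_, fun s hs => (hX s hs).1.2.2⟩
  · simpa only [hX_right] using of_continuousOn hac hX_mono hX_cont hX_zero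
  · simpa only [hX_right, add_sub_cancel_left] using
      of_continuousOn hac hY_mono (continuousOn_id.sub hX_cont) (by rw [hX_zero, sub_zero])

end MonoOnto

/-! ### Matchings -/

section Matchings

variable {d : ℕ} {P Q S T : Curve d} {D μ : ℝ}

/-- The part of `P` up to `x` and the part of `Q` up to `y` can be traversed simultaneously with
distance at most `D`. The parts are allowed to be proper so that the curves can be matched up to a
reachable point of the free space. -/
def Matched (P Q : Curve d) (x y D : ℝ) : Prop :=
  ∃ f g : ℝ → ℝ, MonoOnto f 1 x ∧ MonoOnto g 1 y ∧
    ∀ t ∈ Icc (0 : ℝ) 1, dist (P.eval (f t)) (Q.eval (g t)) ≤ D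

lemma Matched.symm {x y : ℝ} (h : Matched P Q x y D) : Matched Q P y x D :=
  let ⟨f, g, hf, hg, h⟩ := h
  ⟨g, f, hg, hf, fun t ht => by rw [dist_comm]; exact h t ht⟩

lemma frechetDist_le_of_matched (h : Matched P Q (P.size - 1) (Q.size - 1) D) :
    frechetDist P Q ≤ D := by
  obtain ⟨f, g, hf, hg, h⟩ := h
  refine csInf_le_of_le ⟨0, ?_⟩ ⟨f, g, hf, hg, rfl⟩
    (csSup_le ((nonempty_Icc.mpr zero_le_one).image _) (forall_mem_image.mpr h))
  rintro _ ⟨f, g, -, -, rfl⟩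
  exact Real.sSup_nonneg (forall_mem_image.mpr fun _ _ => dist_nonneg)

lemma matched_of_frechetDist_lt (h : frechetDist P Q < D) :
    Matched P Q (P.size - 1) (Q.size - 1) D := by
  have hne : {δ : ℝ | ∃ f g : ℝ → ℝ, P.IsReparam f ∧ Q.IsReparam g ∧
      δ = sSup ((fun t => dist (P.eval (f t)) (Q.eval (g t))) '' Icc 0 1)}.Nonempty :=
    ⟨_, _, _, MonoOnto.mul_left P.size_sub_one_nonneg, MonoOnto.mul_left Q.size_sub_one_nonneg, rfl⟩
  obtain ⟨_, ⟨f, g, hf, hg, rfl⟩, hlt⟩ := exists_lt_of_csInf_lt hne h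
  have hf : MonoOnto f 1 (P.size - 1) := hf
  have hg : MonoOnto g 1 (Q.size - 1) := hg
  obtain ⟨C, hC⟩ := Metric.isBounded_iff.mp (P.isBounded_image_eval.union Q.isBounded_image_eval)
  have hbdd : BddAbove ((fun t => dist (P.eval (f t)) (Q.eval (g t))) '' Icc 0 1) :=
    ⟨C, forall_mem_image.mpr fun t ht => hC (.inl (mem_image_of_mem _ (hf.mapsTo ht).1))
      (.inr (mem_image_of_mem _ (hg.mapsTo ht).1))⟩
  exact ⟨f, g, hf, hg, fun t ht => (le_csSup hbdd (mem_image_of_mem _ ht)).trans hlt.le⟩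

lemma Matched.pullback {σ : ℝ → ℝ} {a x y : ℝ} (hσ : MonoOnto σ a x)
    (hdist : ∀ u ∈ Icc 0 a, dist (P.eval u) (S.eval (σ u)) ≤ μ) (h : Matched S T x y D) :
    Matched P T a y (μ + D) := by
  obtain ⟨f, g, hf, hg, h⟩ := h
  have hx : 0 ≤ x := hf.nonneg_right zero_le_one
  obtain ⟨X, Y, hX, hY, hXY⟩ := MonoOnto.exists_common_refinement hx hσ hf
  have hscale := MonoOnto.mul_left (add_nonneg (hσ.nonneg_left hx) zero_le_one)
  refine ⟨_, _, hX.comp hscale, hg.comp (hY.comp hscale), fun t ht => ?_⟩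
  have hs := hscale.mapsTo ht
  refine (dist_triangle _ (S.eval (σ (X _))) _).trans (add_le_add (hdist _ (hX.mapsTo hs)) ?_)
  rw [hXY _ hs]
  exact h _ (hY.mapsTo hs)

lemma Matched.pushforward {σ : ℝ → ℝ} {a x y : ℝ} (hσ : MonoOnto σ a x)
    (hdist : ∀ u ∈ Icc 0 a, dist (P.eval u) (S.eval (σ u)) ≤ μ) (h : Matched P T a y D) :
    Matched S T x y (μ + D) := by
  obtain ⟨f, g, hf, hg, h⟩ := h
  refine ⟨_, g, hσ.comp hf, hg, fun t ht => ?_⟩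
  refine (dist_triangle _ (P.eval (f t)) _).trans (add_le_add ?_ (h t ht))
  rw [dist_comm]
  exact hdist _ (hf.mapsTo ht)

end Matchings

/-! ### Step counts -/

namespace Timed

variable {α β : Type}

@[simp] lemma bind_val (x : Timed α) (f : α → Timed β) : (x >>= f).val = (f x.val).val := rfl

@[simp] lemma bind_steps (x : Timed α) (f : α → Timed β) :
    (x >>= f).steps = x.steps + (f x.val).steps := rfl

end Timed

@[simp] lemma op_val {α : Type} (a : α) : (op a).val = a := rfl

@[simp] lemma op_steps {α : Type} (a : α) : (op a).steps = 1 := rfl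

lemma op_bind_val {α β : Type} (a : α) (f : α → Timed β) : (op a >>= f).val = (f a).val := rfl

lemma op_bind_steps {α β : Type} (a : α) (f : α → Timed β) :
    (op a >>= f).steps = 1 + (f a).steps := rfl

/-! ### Greedy simplifications -/

section Simplification

variable {d : ℕ} {μ : ℝ}

lemma simplifyFrom_cons (μ : ℝ) (s q : Pt d) (qs : List (Pt d)) :
    (simplifyFrom μ s (q :: qs)).val =
      if μ ≤ dist s q then q :: (simplifyFrom μ q qs).val else (simplifyFrom μ s qs).val := by
  by_cases h : μ ≤ dist s q <;> simp [simplifyFrom, h]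

lemma simplifyFrom_steps_le (μ : ℝ) (s : Pt d) (qs : List (Pt d)) :
    (simplifyFrom μ s qs).steps ≤ 4 * qs.length + 1 := by
  induction qs generalizing s with
  | nil => simp [simplifyFrom]
  | cons q qs ih =>
    have h₁ := ih q
    have h₂ := ih s
    by_cases h : μ ≤ dist s q <;>
      simp only [simplifyFrom, Timed.bind_steps, op_val, op_steps, h, decide_true, decide_false,
        if_true, Bool.false_eq_true, if_false, List.length_cons] <;> omega

lemma simplify_steps_le (μ : ℝ) (P : Curve d) : (simplify μ P).steps ≤ 4 * P.size := by
  have h := simplifyFrom_steps_le μ (P.verts.head P.ne_nil) P.verts.tail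
  have hpos : 0 < P.verts.length := P.size_pos
  simp only [simplify, Timed.bind_steps, op_val, op_steps, List.length_tail, Curve.size] at h ⊢
  omega

/-- The vertices of `P` fall into runs, one for each vertex of `S`: the vertex `l` of `P` belongs
to the run of the vertex `ρ l` of `S` and has distance less than `μ` from it; a run ends because the
next vertex has distance at least `μ`, and that vertex is then the next vertex of `S`. As the
vertices of a curve are repeated past its end, `ρ` is constant there. -/
structure IsCollapse (μ : ℝ) (P S : Curve d) (ρ : ℕ → ℕ) : Prop where
  zero : ρ 0 = 0
  last : ∀ l, P.size ≤ l + 1 → ρ l + 1 = S.size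
  step : ∀ l, ρ (l + 1) = ρ l ∨ ρ (l + 1) = ρ l + 1 ∧ S.vertex (ρ l + 1) = P.vertex (l + 1) ∧
    μ ≤ dist (S.vertex (ρ l)) (S.vertex (ρ l + 1))
  near : ∀ l, dist (P.vertex l) (S.vertex (ρ l)) < μ

namespace Curve

lemma vertex_mk_singleton (p : Pt d) (h : [p] ≠ []) (l : ℕ) : vertex ⟨[p], h⟩ l = p := by
  cases l <;> rfl

lemma vertex_mk_cons_succ (p q : Pt d) (qs : List (Pt d)) (l : ℕ) :
    vertex ⟨p :: q :: qs, List.cons_ne_nil _ _⟩ (l + 1) =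
      vertex ⟨q :: qs, List.cons_ne_nil _ _⟩ l := by
  simp [vertex, List.getLast_cons (List.cons_ne_nil q qs)]

end Curve

namespace IsCollapse

variable {p q s : Pt d} {qs rs : List (Pt d)} {ρ : ℕ → ℕ}

lemma single (hp : dist p s < μ) :
    IsCollapse μ ⟨[p], List.cons_ne_nil _ _⟩ ⟨[s], List.cons_ne_nil _ _⟩ fun _ => 0 where
  zero := rfl
  last _ _ := rfl
  step _ := .inl rfl
  near l := by rwa [Curve.vertex_mk_singleton, Curve.vertex_mk_singleton]

lemma cons_near (hp : dist p s < μ)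
    (h : IsCollapse μ ⟨q :: qs, List.cons_ne_nil _ _⟩ ⟨s :: rs, List.cons_ne_nil _ _⟩ ρ) :
    IsCollapse μ ⟨p :: q :: qs, List.cons_ne_nil _ _⟩ ⟨s :: rs, List.cons_ne_nil _ _⟩
      fun l => l.casesOn 0 ρ where
  zero := rfl
  last
    | 0, hl => by simp [Curve.size] at hl
    | l + 1, hl => h.last l (Nat.le_of_succ_le_succ hl)
  step
    | 0 => .inl h.zero
    | l + 1 => by rw [Curve.vertex_mk_cons_succ]; exact h.step l
  near
    | 0 => hp
    | l + 1 => by rw [Curve.vertex_mk_cons_succ]; exact h.near l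

lemma cons_far (hp : dist p s < μ) (hq : μ ≤ dist s q)
    (h : IsCollapse μ ⟨q :: qs, List.cons_ne_nil _ _⟩ ⟨q :: rs, List.cons_ne_nil _ _⟩ ρ) :
    IsCollapse μ ⟨p :: q :: qs, List.cons_ne_nil _ _⟩ ⟨s :: q :: rs, List.cons_ne_nil _ _⟩
      fun l => l.casesOn 0 fun l => ρ l + 1 where
  zero := rfl
  last
    | 0, hl => by simp [Curve.size] at hl
    | l + 1, hl => congrArg (· + 1) (h.last l (Nat.le_of_succ_le_succ hl))
  step
    | 0 => .inr ⟨congrArg (· + 1) h.zero, rfl, hq⟩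
    | l + 1 => by
      simp only [Curve.vertex_mk_cons_succ, add_left_inj]
      exact h.step l
  near
    | 0 => hp
    | l + 1 => by simp only [Curve.vertex_mk_cons_succ]; exact h.near l

end IsCollapse

lemma exists_isCollapse_simplifyFrom {p s : Pt d} (qs : List (Pt d)) (hp : dist p s < μ) :
    ∃ ρ, IsCollapse μ ⟨p :: qs, List.cons_ne_nil _ _⟩
      ⟨s :: (simplifyFrom μ s qs).val, List.cons_ne_nil _ _⟩ ρ := by
  induction qs generalizing s p with
  | nil => exact ⟨_, .single hp⟩
  | cons q qs ih =>
    simp only [simplifyFrom_cons]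
    split_ifs with hq
    · obtain ⟨ρ, h⟩ := ih (p := q) (s := q) (by rw [dist_self]; exact dist_nonneg.trans_lt hp)
      exact ⟨_, .cons_far hp hq h⟩
    · obtain ⟨ρ, h⟩ := ih (p := q) (s := s) (by rw [dist_comm]; exact not_le.mp hq)
      exact ⟨_, .cons_near hp h⟩

/-- `S` is the greedy `μ`-simplification of `P`, and the vertex `l` of `P` belongs to the run of the
vertex `ρ l` of `S`. -/
structure IsSimplification (μ : ℝ) (P S : Curve d) (ρ : ℕ → ℕ) : Prop extends
    IsCollapse μ P S ρ where
  vertex_zero : S.vertex 0 = P.vertex 0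

lemma exists_isSimplification (hμ : 0 < μ) :
    ∀ P : Curve d, ∃ ρ, IsSimplification μ P (simplify μ P).val ρ
  | ⟨p :: qs, _⟩ =>
    let ⟨ρ, h⟩ := exists_isCollapse_simplifyFrom (p := p) (s := p) qs (by rwa [dist_self])
    ⟨ρ, h, rfl⟩

namespace IsSimplification

variable {P S : Curve d} {ρ : ℕ → ℕ}

lemma scale_pos (h : IsSimplification μ P S ρ) : 0 < μ :=
  dist_nonneg.trans_lt (h.near 0)

lemma step_or (h : IsSimplification μ P S ρ) (l : ℕ) : ρ (l + 1) = ρ l ∨ ρ (l + 1) = ρ l + 1 :=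
  (h.step l).imp_right And.left

lemma mono (h : IsSimplification μ P S ρ) : Monotone ρ :=
  monotone_nat_of_le_succ fun l => by rcases h.step_or l with h | h <;> omega

lemma le_self (h : IsSimplification μ P S ρ) (l : ℕ) : ρ l ≤ l := by
  induction l with
  | zero => exact h.zero.le
  | succ l ih => rcases h.step_or l with h | h <;> omega

lemma index_last (h : IsSimplification μ P S ρ) : ρ (P.size - 1) = S.size - 1 :=
  Nat.eq_sub_of_add_eq (h.last _ (by omega))

lemma size_le (h : IsSimplification μ P S ρ) : S.size ≤ P.size := by
  have := h.le_self (P.size - 1)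
  have := h.index_last
  have := P.size_pos
  omega

lemma monoOnto_interp (h : IsSimplification μ P S ρ) :
    MonoOnto (interp fun l => (ρ l : ℝ)) (P.size - 1) (S.size - 1) := by
  have := MonoOnto.interp (u := fun l => (ρ l : ℝ)) (Nat.mono_cast.comp h.mono)
    (by rw [h.zero, Nat.cast_zero]) (P.size - 1)
  rwa [h.index_last, P.cast_size_sub_one, S.cast_size_sub_one] at this

lemma exists_near_le (h : IsSimplification μ P S ρ) :
    ∃ μ' < μ, ∀ l, dist (P.vertex l) (S.vertex (ρ l)) ≤ μ' := by
  obtain ⟨k, -, hk⟩ := (Finset.range P.size).exists_max_image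
    (fun l => dist (P.vertex l) (S.vertex (ρ l))) ⟨0, Finset.mem_range.mpr P.size_pos⟩
  refine ⟨_, h.near k, fun l => ?_⟩
  rcases lt_or_ge l P.size with hl | hl
  · exact hk l (Finset.mem_range.mpr hl)
  · have hlast := hk (P.size - 1) (Finset.mem_range.mpr (Nat.sub_lt P.size_pos one_pos))
    rwa [P.vertex_of_size_le (by omega), S.vertex_of_size_le (h.last _ (by omega)).ge] at hlast ⊢

lemma dist_eval_interp_le (h : IsSimplification μ P S ρ) {μ' : ℝ}
    (hμ' : ∀ l, dist (P.vertex l) (S.vertex (ρ l)) ≤ μ') {x : ℝ} (hx : 0 ≤ x) :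
    dist (P.eval x) (S.eval (interp (fun l => (ρ l : ℝ)) x)) ≤ μ' :=
  (congrArg _ (interp_interp h.step_or S.vertex hx)).trans_le (dist_interp_le hμ' hx)

end IsSimplification

end Simplification

/-! ### The length of a curve inside a ball -/

open scoped NNReal in
/-- The values strictly between `min (h u) R` and `min (h v) R` are all taken by `h` at points of
`[u, v]` where `h` is at most `R`, and a Lipschitz map expands lengths by at most its constant. -/
lemma abs_min_sub_min_le_mul_volume {h : ℝ → ℝ} {K : ℝ≥0} (hh : LipschitzWith K h) (R : ℝ)
    {u v : ℝ} (huv : u ≤ v) :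
    |min (h v) R - min (h u) R| ≤ K * volume.real ({t | h t ≤ R} ∩ Ioc u v) := by
  have hfin : volume ({t | h t ≤ R} ∩ Ioc u v) ≠ ⊤ := measure_inter_ne_top_of_right_ne_top (by simp)
  have hcont : ContinuousOn (fun t => min (h t) R) (uIcc u v) :=
    (hh.continuous.min continuous_const).continuousOn
  have hsub : uIoo (min (h u) R) (min (h v) R) ⊆ h '' ({t | h t ≤ R} ∩ Ioc u v) := by
    intro y hy
    obtain ⟨t, ht, rfl⟩ := intermediate_value_uIcc hcont (uIoo_subset_uIcc_self hy)
    rw [uIcc_of_le huv] at ht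
    have hlt : min (h t) R < R := hy.2.trans_le (max_le (min_le_right _ _) (min_le_right _ _))
    have hne : t ≠ u := by rintro rfl; exact left_notMem_uIoo hy
    have htR : h t < R := (min_lt_iff.mp hlt).resolve_right (lt_irrefl R)
    exact ⟨t, ⟨htR.le, ht.1.lt_of_ne' hne, ht.2⟩, (min_eq_left htR.le).symm⟩
  have hle : volume (uIoo (min (h u) R) (min (h v) R)) ≤ K * volume ({t | h t ≤ R} ∩ Ioc u v) := by
    refine (measure_mono hsub).trans ?_
    have := hh.hausdorffMeasure_image_le zero_le_one ({t | h t ≤ R} ∩ Ioc u v)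
    rwa [hausdorffMeasure_real, ENNReal.rpow_one] at this
  rw [Real.volume_uIoo] at hle
  have := ENNReal.toReal_mono (ENNReal.mul_ne_top ENNReal.coe_ne_top hfin) hle
  rwa [ENNReal.toReal_ofReal (abs_nonneg _), ENNReal.toReal_mul, ENNReal.coe_toReal] at this

section Segments

variable {E : Type*} [SeminormedAddCommGroup E] [NormedSpace ℝ E]

/-- The parameters in `[0, 1]` for which the segment from `a` to `b` is in the ball `B(z, R)`. -/
def ballParams (a b z : E) (R : ℝ) : Set ℝ :=
  {t : ℝ | t ∈ Icc (0 : ℝ) 1 ∧ AffineMap.lineMap a b t ∈ Metric.closedBall z R}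

/-- The length of the part of the segment from `a` to `b` that lies in the ball `B(z, R)` and has
its parameter in `s`. -/
noncomputable def segmentLength (a b z : E) (R : ℝ) (s : Set ℝ) : ℝ :=
  dist a b * volume.real (ballParams a b z R ∩ s)

lemma ballParams_subset (a b z : E) (R : ℝ) : ballParams a b z R ⊆ Icc 0 1 := fun _ h => h.1

lemma measurableSet_ballParams (a b z : E) (R : ℝ) : MeasurableSet (ballParams a b z R) :=
  measurableSet_Icc.inter
    (Metric.isClosed_closedBall.preimage AffineMap.lineMap_continuous).measurableSet

lemma volume_ballParams_ne_top (a b z : E) (R : ℝ) : volume (ballParams a b z R) ≠ ⊤ :=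
  measure_ne_top_of_subset (ballParams_subset a b z R) (by simp)

lemma segmentLength_nonneg (a b z : E) (R : ℝ) (s : Set ℝ) : 0 ≤ segmentLength a b z R s :=
  mul_nonneg dist_nonneg measureReal_nonneg

lemma segmentLength_mono (a b z : E) (R : ℝ) {s t : Set ℝ} (hst : s ⊆ t) :
    segmentLength a b z R s ≤ segmentLength a b z R t :=
  mul_le_mul_of_nonneg_left
    (measureReal_mono (inter_subset_inter_right _ hst)
      (measure_inter_ne_top_of_left_ne_top (volume_ballParams_ne_top a b z R))) dist_nonneg

lemma segmentLength_Ioc (a b z : E) (R : ℝ) {x y : ℝ} (h : x ≤ y) :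
    segmentLength a b z R (Ioc x y) =
      segmentLength a b z R (Iic y) - segmentLength a b z R (Iic x) := by
  rw [segmentLength, segmentLength, segmentLength, ← mul_sub, ← Iic_sdiff_Iic,
    inter_sdiff_distrib_left,
    measureReal_sdiff (inter_subset_inter_right _ (Iic_subset_Iic.mpr h))
      ((measurableSet_ballParams a b z R).inter measurableSet_Iic)
      (measure_inter_ne_top_of_left_ne_top (volume_ballParams_ne_top a b z R))]

lemma abs_clipped_dist_sub_le_segmentLength (a b z : E) (R : ℝ) {u v : ℝ} (hu : 0 ≤ u)
    (huv : u ≤ v) (hv : v ≤ 1) :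
    |min (dist (AffineMap.lineMap a b v) z) R - min (dist (AffineMap.lineMap a b u) z) R| ≤
      segmentLength a b z R (Ioc u v) := by
  have hlip : LipschitzWith (nndist a b) fun t : ℝ => dist (AffineMap.lineMap a b t) z := by
    have := (LipschitzWith.dist_left z).comp (lipschitzWith_lineMap (𝕜 := ℝ) a b)
    rwa [one_mul] at this
  refine (abs_min_sub_min_le_mul_volume hlip R huv).trans_eq ?_
  rw [segmentLength, coe_nndist]
  congr 2
  ext t
  simp only [ballParams, mem_inter_iff, mem_ofPred_eq, mem_Icc, mem_Ioc, Metric.mem_closedBall]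
  grind

lemma segmentLength_univ_of_mem {a b z : E} {R : ℝ} (ha : dist a z ≤ R) (hb : dist b z ≤ R) :
    segmentLength a b z R univ = dist a b := by
  have : ballParams a b z R = Icc 0 1 := Subset.antisymm (ballParams_subset a b z R) fun t ht =>
    ⟨ht, (convex_closedBall z R).lineMap_mem ha hb ht⟩
  simp [segmentLength, this]

lemma le_segmentLength_univ_of_dist_le {a b z : E} (R : ℝ) {r t : ℝ} (ht : t ∈ Icc (0 : ℝ) 1)
    (h : dist (AffineMap.lineMap a b t) z ≤ r) :
    min (dist a b) (R - r) ≤ segmentLength a b z R univ := by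
  have hr : min (dist (AffineMap.lineMap a b t) z) R ≤ r := (min_le_left _ _).trans h
  have hsub := fun s => segmentLength_mono a b z R (subset_univ s)
  by_cases ha : dist a z ≤ R
  · by_cases hb : dist b z ≤ R
    · exact (min_le_left _ _).trans (segmentLength_univ_of_mem ha hb).ge
    · have hexit := abs_clipped_dist_sub_le_segmentLength a b z R ht.1 ht.2 le_rfl
      rw [AffineMap.lineMap_apply_one, min_eq_right (not_le.mp hb).le] at hexit
      exact (min_le_right _ _).trans (by linarith [le_of_abs_le hexit, hsub (Ioc t 1)])
  · have henter := abs_clipped_dist_sub_le_segmentLength a b z R le_rfl ht.1 ht.2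
    rw [AffineMap.lineMap_apply_zero, min_eq_right (not_le.mp ha).le] at henter
    exact (min_le_right _ _).trans (by linarith [neg_le_of_abs_le henter, hsub (Ioc 0 t)])

end Segments

namespace Curve

variable {d : ℕ}

/-- The length of the edge `l` of `P` inside the ball `B(z, R)`. -/
noncomputable def edgeLength (P : Curve d) (z : Pt d) (R : ℝ) (l : ℕ) : ℝ :=
  segmentLength (P.vertex l) (P.vertex (l + 1)) z R univ

/-- The length of `P` inside the ball `B(z, R)` up to the parameter `x`. -/
noncomputable def lengthTo (P : Curve d) (z : Pt d) (R x : ℝ) : ℝ :=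
  ∑ l ∈ Finset.range (P.size - 1),
    segmentLength (P.vertex l) (P.vertex (l + 1)) z R (Iic (x - l))

variable (P : Curve d) (z : Pt d) (R : ℝ)

lemma lengthInBall_eq_sum_edgeLength :
    P.lengthInBall z R = ∑ l ∈ Finset.range (P.size - 1), P.edgeLength z R l := by
  simp only [edgeLength, segmentLength, inter_univ]
  rfl

lemma lengthTo_nonneg (x : ℝ) : 0 ≤ P.lengthTo z R x :=
  Finset.sum_nonneg fun _ _ => segmentLength_nonneg _ _ _ _ _

lemma lengthTo_le_lengthInBall (x : ℝ) : P.lengthTo z R x ≤ P.lengthInBall z R := by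
  rw [lengthInBall_eq_sum_edgeLength]
  exact Finset.sum_le_sum fun l _ => segmentLength_mono _ _ _ _ (subset_univ _)

lemma monotone_lengthTo : Monotone (P.lengthTo z R) := fun _ _ h =>
  Finset.sum_le_sum fun _ _ =>
    segmentLength_mono _ _ _ _ (Iic_subset_Iic.mpr (sub_le_sub_right h _))

lemma abs_clipped_dist_eval_sub_le_of_mem_edge {l : ℕ} {x y : ℝ}
    (hx : x ∈ Icc (l : ℝ) (l + 1)) (hy : y ∈ Icc (l : ℝ) (l + 1)) (hxy : x ≤ y) :
    |min (dist (P.eval y) z) R - min (dist (P.eval x) z) R| ≤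
      P.lengthTo z R y - P.lengthTo z R x := by
  rcases lt_or_ge (l + 1) P.size with hl | hl
  · rw [P.eval_eq_lineMap hx, P.eval_eq_lineMap hy]
    refine (abs_clipped_dist_sub_le_segmentLength _ _ _ _ (sub_mem_unitInterval hx).1
      (sub_le_sub_right hxy _) (sub_mem_unitInterval hy).2).trans ?_
    rw [segmentLength_Ioc _ _ _ _ (sub_le_sub_right hxy _), lengthTo, lengthTo,
      ← Finset.sum_sub_distrib]
    refine Finset.single_le_sum (f := fun l : ℕ =>
      segmentLength (P.vertex l) (P.vertex (l + 1)) z R (Iic (y - l)) -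
        segmentLength (P.vertex l) (P.vertex (l + 1)) z R (Iic (x - l))) (fun k _ => ?_)
      (Finset.mem_range.mpr (Nat.lt_sub_of_add_lt hl))
    exact sub_nonneg.mpr
      (segmentLength_mono _ _ _ _ (Iic_subset_Iic.mpr (sub_le_sub_right hxy _)))
  · have hlast : (P.size : ℝ) - 1 ≤ l := by
      rw [sub_le_iff_le_add]
      exact_mod_cast hl
    rw [P.eval_of_size_le (hlast.trans hx.1), P.eval_of_size_le (hlast.trans hy.1), sub_self,
      abs_zero]
    exact sub_nonneg.mpr (P.monotone_lengthTo z R hxy)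

/-- To change the clipped distance to `z`, the curve has to run inside the ball. -/
lemma abs_clipped_dist_eval_sub_le {x y : ℝ} (hx : 0 ≤ x) (hxy : x ≤ y) :
    |min (dist (P.eval y) z) R - min (dist (P.eval x) z) R| ≤
      P.lengthTo z R y - P.lengthTo z R x := by
  have hsub : MonotoneOn (fun x => P.lengthTo z R x - min (dist (P.eval x) z) R) (Ici 0) :=
    monotoneOn_Ici_of_unit_steps fun l x hx y hy hxy => by
      linarith [le_of_abs_le (P.abs_clipped_dist_eval_sub_le_of_mem_edge z R hx hy hxy)]
  have hadd : MonotoneOn (fun x => P.lengthTo z R x + min (dist (P.eval x) z) R) (Ici 0) :=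
    monotoneOn_Ici_of_unit_steps fun l x hx y hy hxy => by
      linarith [neg_le_of_abs_le (P.abs_clipped_dist_eval_sub_le_of_mem_edge z R hx hy hxy)]
  have h₁ := hsub hx (hx.trans hxy) hxy
  have h₂ := hadd hx (hx.trans hxy) hxy
  rw [abs_le]
  constructor <;> linarith

end Curve

/-! ### Simplifications of packed curves -/

namespace IsSimplification

variable {d : ℕ} {μ c : ℝ} {P S : Curve d} {ρ : ℕ → ℕ} {k : ℕ}

lemma exists_run_end (h : IsSimplification μ P S ρ) (hk : k + 1 < S.size) :
    ∃ l, l + 1 < P.size ∧ ρ l = k ∧ S.vertex (k + 1) = P.vertex (l + 1) ∧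
      μ ≤ dist (S.vertex k) (S.vertex (k + 1)) := by
  have hex : ∃ l, k < ρ l := ⟨P.size - 1, h.index_last ▸ Nat.lt_sub_of_add_lt hk⟩
  obtain ⟨l, hl⟩ : ∃ l, Nat.find hex = l + 1 := Nat.exists_eq_succ_of_ne_zero fun h0 => by
    have := Nat.find_spec hex
    rw [h0, h.zero] at this
    omega
  have hlt : k < ρ (l + 1) := hl ▸ Nat.find_spec hex
  have hle : ρ l ≤ k := not_lt.mp (Nat.find_min hex (hl ▸ l.lt_succ_self))
  have hsize : l + 1 < P.size := by
    by_contra! hge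
    have := h.last l (by omega)
    omega
  rcases h.step l with hstay | ⟨hstep, hv, hfar⟩
  · omega
  · obtain rfl : ρ l = k := by omega
    exact ⟨l, hsize, rfl, hv, hfar⟩

/-- The edges of `P` that start in the run of the vertex `k` of a simplification with index map
`ρ`. -/
def runEdges (P : Curve d) (ρ : ℕ → ℕ) (k : ℕ) : Finset ℕ :=
  (Finset.range (P.size - 1)).filter fun l => ρ l = k

lemma dist_run_le_sum (h : IsSimplification μ P S ρ) {l : ℕ} (hl : ρ l = k) :
    dist (S.vertex k) (P.vertex l) ≤
      ∑ j ∈ Finset.range l with ρ j = k, dist (P.vertex j) (P.vertex (j + 1)) := by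
  induction l with
  | zero =>
    obtain rfl : k = 0 := hl.symm.trans h.zero
    simp [h.vertex_zero]
  | succ l ih =>
    rcases h.step l with hstay | ⟨hstep, hv, -⟩
    · have hlk : ρ l = k := hstay.symm.trans hl
      rw [Finset.range_add_one, Finset.filter_insert, if_pos hlk, Finset.sum_insert (by simp)]
      linarith [ih hlk, dist_triangle (S.vertex k) (P.vertex l) (P.vertex (l + 1))]
    · rw [← hl, hstep, hv, dist_self]
      exact Finset.sum_nonneg fun _ _ => dist_nonneg

lemma dist_edge_le_sum (h : IsSimplification μ P S ρ) (hk : k + 1 < S.size) :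
    dist (S.vertex k) (S.vertex (k + 1)) ≤
      ∑ l ∈ runEdges P ρ k, dist (P.vertex l) (P.vertex (l + 1)) := by
  obtain ⟨l, hl, hlk, hv, -⟩ := h.exists_run_end hk
  calc dist (S.vertex k) (S.vertex (k + 1))
      ≤ dist (P.vertex l) (P.vertex (l + 1)) +
          ∑ j ∈ Finset.range l with ρ j = k, dist (P.vertex j) (P.vertex (j + 1)) := by
        rw [hv]
        linarith [h.dist_run_le_sum hlk,
          dist_triangle (S.vertex k) (P.vertex l) (P.vertex (l + 1))]
    _ = ∑ j ∈ Finset.range (l + 1) with ρ j = k, dist (P.vertex j) (P.vertex (j + 1)) := by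
        rw [Finset.range_add_one, Finset.filter_insert, if_pos hlk, Finset.sum_insert (by simp)]
    _ ≤ _ := Finset.sum_le_sum_of_subset_of_nonneg
        (Finset.filter_subset_filter _ (Finset.range_subset_range.mpr (Nat.le_sub_one_of_lt hl)))
        fun _ _ _ => dist_nonneg

lemma exists_le_edgeLength_of_long_edge (h : IsSimplification μ P S ρ) (hk : k + 1 < S.size)
    {z : Pt d} {r t : ℝ} (ht : t ∈ Icc (0 : ℝ) 1)
    (hz : dist (AffineMap.lineMap (S.vertex k) (S.vertex (k + 1)) t) z ≤ r)
    (hlong : 2 * μ ≤ dist (S.vertex k) (S.vertex (k + 1))) :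
    ∃ l ∈ runEdges P ρ k, μ ≤ P.edgeLength z (r + 4 * μ) l := by
  obtain ⟨l, hl, hlk, hv, -⟩ := h.exists_run_end hk
  have hμ := h.scale_pos
  have hnear : dist (P.vertex l) (S.vertex k) ≤ μ := hlk ▸ (h.near l).le
  have hclose := dist_lineMap_lineMap_le hnear
    (by rw [hv, dist_self]; exact hμ.le : dist (P.vertex (l + 1)) (S.vertex (k + 1)) ≤ μ) ht
  have hmem : dist (AffineMap.lineMap (P.vertex l) (P.vertex (l + 1)) t) z ≤ r + μ :=
    (dist_triangle _ _ z).trans (by linarith)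
  have hlen : μ ≤ dist (P.vertex l) (P.vertex (l + 1)) := by
    rw [hv] at hlong
    linarith [dist_triangle_left (S.vertex k) (P.vertex (l + 1)) (P.vertex l)]
  refine ⟨l, Finset.mem_filter.mpr ⟨Finset.mem_range.mpr (by omega), hlk⟩, ?_⟩
  exact (le_min hlen (by linarith)).trans (le_segmentLength_univ_of_dist_le _ ht hmem)

lemma edgeLength_eq_dist_of_short_edge (h : IsSimplification μ P S ρ)
    {z : Pt d} {r t : ℝ} (ht : t ∈ Icc (0 : ℝ) 1)
    (hz : dist (AffineMap.lineMap (S.vertex k) (S.vertex (k + 1)) t) z ≤ r)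
    (hshort : dist (S.vertex k) (S.vertex (k + 1)) ≤ 2 * μ) {l : ℕ} (hl : ρ l = k) :
    P.edgeLength z (r + 4 * μ) l = dist (P.vertex l) (P.vertex (l + 1)) := by
  have hμ := h.scale_pos
  have hvertex : dist (S.vertex k) z ≤ r + 2 * μ := by
    have hsmall : dist (S.vertex k) (AffineMap.lineMap (S.vertex k) (S.vertex (k + 1)) t) ≤
        dist (S.vertex k) (S.vertex (k + 1)) := by
      rw [dist_left_lineMap, Real.norm_of_nonneg ht.1]
      exact mul_le_of_le_one_left dist_nonneg ht.2
    linarith [dist_triangle (S.vertex k)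
      (AffineMap.lineMap (S.vertex k) (S.vertex (k + 1)) t) z]
  have hl_near : dist (P.vertex l) (S.vertex k) < μ := hl ▸ h.near l
  have hl'_near : dist (P.vertex (l + 1)) (S.vertex k) ≤ 2 * μ := by
    rcases h.step l with hstay | ⟨-, hv, -⟩
    · have := h.near (l + 1)
      rw [hstay, hl] at this
      linarith
    · rwa [← hv, hl, dist_comm]
  exact segmentLength_univ_of_mem
    (by linarith [dist_triangle (P.vertex l) (S.vertex k) z])
    (by linarith [dist_triangle (P.vertex (l + 1)) (S.vertex k) z])

/-- A long edge of `S` is close to the last edge of the run, a short one is contained in the ball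
`B(z, r + 4 μ)` together with its whole run. -/
lemma le_sum_edgeLength_runEdges (h : IsSimplification μ P S ρ) (hk : k + 1 < S.size) {z : Pt d}
    {r x : ℝ} (hx : x ∈ Icc (k : ℝ) (k + 1)) (hz : dist (S.eval x) z ≤ r) :
    μ ≤ ∑ l ∈ runEdges P ρ k, P.edgeLength z (r + 4 * μ) l := by
  rw [S.eval_eq_lineMap hx] at hz
  have ht := sub_mem_unitInterval hx
  rcases le_total (2 * μ) (dist (S.vertex k) (S.vertex (k + 1))) with hlong | hshort
  · obtain ⟨l, hl, hle⟩ := h.exists_le_edgeLength_of_long_edge hk ht hz hlong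
    exact hle.trans (Finset.single_le_sum (f := P.edgeLength z (r + 4 * μ))
      (fun _ _ => segmentLength_nonneg _ _ _ _ _) hl)
  · obtain ⟨-, -, -, -, hfar⟩ := h.exists_run_end hk
    refine hfar.trans ((h.dist_edge_le_sum hk).trans_eq (Finset.sum_congr rfl fun l hl => ?_))
    exact (h.edgeLength_eq_dist_of_short_edge ht hz hshort (Finset.mem_filter.mp hl).2).symm

theorem card_edges_mul_le (h : IsSimplification μ P S ρ) (hP : P.IsPacked c) {z : Pt d} {r : ℝ}
    (hr : 0 ≤ r) {A : Finset ℕ} (hA : ∀ k ∈ A, k + 1 < S.size)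
    (hz : ∀ k ∈ A, ∃ x ∈ Icc (k : ℝ) (k + 1), dist (S.eval x) z ≤ r) :
    (A.card : ℝ) * μ ≤ c * (r + 4 * μ) := by
  have hdisj : (A : Set ℕ).PairwiseDisjoint (runEdges P ρ) := fun k _ k' _ hne =>
    Finset.disjoint_filter.mpr fun l _ hk hk' => hne (hk.symm.trans hk')
  calc (A.card : ℝ) * μ = A.card • μ := (nsmul_eq_mul _ _).symm
    _ ≤ ∑ k ∈ A, ∑ l ∈ runEdges P ρ k, P.edgeLength z (r + 4 * μ) l :=
        Finset.card_nsmul_le_sum _ _ _ fun k hk =>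
          let ⟨_, hx, hxz⟩ := hz k hk
          h.le_sum_edgeLength_runEdges (hA k hk) hx hxz
    _ = ∑ l ∈ A.biUnion (runEdges P ρ), P.edgeLength z (r + 4 * μ) l :=
        (Finset.sum_biUnion hdisj).symm
    _ ≤ ∑ l ∈ Finset.range (P.size - 1), P.edgeLength z (r + 4 * μ) l :=
        Finset.sum_le_sum_of_subset_of_nonneg
          (Finset.biUnion_subset.mpr fun _ _ => Finset.filter_subset _ _)
          fun _ _ _ => segmentLength_nonneg _ _ _ _ _
    _ = P.lengthInBall z (r + 4 * μ) := (P.lengthInBall_eq_sum_edgeLength z _).symm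
    _ ≤ c * (r + 4 * μ) := hP z _ (by linarith [h.scale_pos])

end IsSimplification

/-! ### Free intervals -/

section FreeInterval

variable {d : ℕ} {δ : ℝ}

lemma dist_lineMap_sq (s a b : Pt d) (t : ℝ) :
    dist (AffineMap.lineMap a b t) s ^ 2 =
      inner ℝ (b - a) (b - a) * t ^ 2 + 2 * inner ℝ (b - a) (a - s) * t +
        inner ℝ (a - s) (a - s) := by
  have hsub : (AffineMap.lineMap a b t : Pt d) - s = t • (b - a) + (a - s) := by
    rw [AffineMap.lineMap_apply_module]
    module
  rw [dist_eq_norm, hsub, norm_add_sq_real, norm_smul, mul_pow, real_inner_smul_left,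
    real_inner_self_eq_norm_sq, real_inner_self_eq_norm_sq, Real.norm_eq_abs, sq_abs]
  ring

lemma quadratic_nonpos_iff {A B C t : ℝ} (hA : 0 < A) :
    A * t ^ 2 + 2 * B * t + C ≤ 0 ↔ (A * t + B) ^ 2 ≤ B * B - A * C := by
  rw [← mul_le_mul_iff_right₀ hA, mul_zero, ← sub_nonpos (b := B * B - A * C)]
  ring_nf

lemma sq_le_iff_mem_Icc {A B D t : ℝ} (hA : 0 < A) (hD : 0 ≤ D) :
    (A * t + B) ^ 2 ≤ D ↔ t ∈ Icc ((-B - √D) / A) ((-B + √D) / A) := by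
  rw [Real.sq_le hD, mem_Icc, div_le_iff₀ hA, le_div_iff₀ hA, mul_comm t A]
  constructor <;> rintro ⟨h, h'⟩ <;> constructor <;> linarith

lemma freeInterval_val (δ : ℝ) (s a b : Pt d) {A B D : ℝ} (hA : A = inner ℝ (b - a) (b - a))
    (hB : B = inner ℝ (b - a) (a - s)) (hD : D = B * B - A * (inner ℝ (a - s) (a - s) - δ * δ)) :
    (freeInterval δ s a b).val =
      if A = 0 then if inner ℝ (a - s) (a - s) - δ * δ ≤ 0 then some (0, 1) else none
      else if D < 0 then none
      else if max 0 ((-B - √D) / A) ≤ min 1 ((-B + √D) / A) then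
        some (max 0 ((-B - √D) / A), min 1 ((-B + √D) / A))
      else none := by
  subst hD hB hA
  simp only [freeInterval, op_bind_val, op_val, apply_ite Timed.val, decide_eq_true_eq]

lemma freeInterval_steps_le (δ : ℝ) (s a b : Pt d) : (freeInterval δ s a b).steps ≤ 23 := by
  simp only [freeInterval, op_bind_steps, op_steps, apply_ite Timed.steps,
    decide_eq_true_eq]
  split_ifs <;> norm_num

lemma fst_le_snd_of_mem_freeInterval {s a b : Pt d} {I : ℝ × ℝ}
    (h : I ∈ (freeInterval δ s a b).val) : I.1 ≤ I.2 := by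
  rw [freeInterval_val δ s a b rfl rfl rfl] at h
  split_ifs at h with _ _ _ hle <;> cases h
  · exact zero_le_one
  · exact hle

theorem exists_mem_freeInterval_iff (hδ : 0 ≤ δ) (s a b : Pt d) (t : ℝ) :
    (∃ I ∈ (freeInterval δ s a b).val, t ∈ Icc I.1 I.2) ↔
      t ∈ Icc (0 : ℝ) 1 ∧ dist (AffineMap.lineMap a b t) s ≤ δ := by
  rw [← sq_le_sq₀ dist_nonneg hδ, dist_lineMap_sq, ← sub_nonpos, add_sub_assoc, sq δ,
    freeInterval_val δ s a b rfl rfl rfl]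
  set A : ℝ := inner ℝ (b - a) (b - a)
  set B : ℝ := inner ℝ (b - a) (a - s) with hB
  set C : ℝ := inner ℝ (a - s) (a - s) - δ * δ
  by_cases hA0 : A = 0
  · have hB0 : B = 0 := by rw [hB, inner_self_eq_zero.mp hA0, inner_zero_left]
    by_cases hC : C ≤ 0 <;> simp [hA0, hB0, hC]
  have hA_pos : 0 < A := real_inner_self_nonneg.lt_of_ne' hA0
  rw [if_neg hA0, quadratic_nonpos_iff hA_pos]
  rcases lt_or_ge (B * B - A * C) 0 with hD | hD
  · simp [hD, (hD.trans_le (sq_nonneg (A * t + B))).not_ge]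
  · rw [if_neg hD.not_gt, sq_le_iff_mem_Icc hA_pos hD, ← mem_inter_iff, Icc_inter_Icc]
    split_ifs with hle
    · simp only [Option.mem_some_iff, exists_eq_left']
    · simp [Icc_eq_empty hle]

end FreeInterval

/-! ### Exits of a cell -/

lemma exitSide_val (I : Option (ℝ × ℝ)) (o a : Option ℝ) : (exitSide I o a).val =
    I.bind fun I => if a.isSome then some I.1 else
      o.bind fun l => if max I.1 l ≤ I.2 then some (max I.1 l) else none := by
  rcases I with _ | ⟨lo, hi⟩ <;> rcases a with _ | _ <;> rcases o with _ | l <;> try rfl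
  by_cases h : max lo l ≤ hi <;> simp only [exitSide, Timed.bind_val, op_val, h, decide_true,
    decide_false, Option.bind_some, Option.isSome_none, if_true, Bool.false_eq_true, if_false]

lemma exitSide_steps_le (I : Option (ℝ × ℝ)) (o a : Option ℝ) : (exitSide I o a).steps ≤ 6 := by
  rcases I with _ | ⟨lo, hi⟩ <;> rcases a with _ | a <;> rcases o with _ | o <;>
    simp [exitSide, apply_ite Timed.steps]

lemma exitSide_sound {I : Option (ℝ × ℝ)} {o a : Option ℝ} {x : ℝ} (hI : ∀ J ∈ I, J.1 ≤ J.2)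
    (h : (exitSide I o a).val = some x) :
    (∃ J ∈ I, x ∈ Icc J.1 J.2) ∧ (a.isSome ∨ ∃ l ∈ o, l ≤ x) := by
  rw [exitSide_val] at h
  obtain ⟨J, rfl, hJ⟩ := Option.bind_eq_some_iff.mp h
  split_ifs at hJ with ha
  · obtain rfl := Option.some_injective _ hJ
    exact ⟨⟨J, rfl, le_rfl, hI J rfl⟩, .inl ha⟩
  · obtain ⟨l, rfl, hl⟩ := Option.bind_eq_some_iff.mp hJ
    split_ifs at hl with hle
    obtain rfl := Option.some_injective _ hl
    exact ⟨⟨J, rfl, le_max_left _ _, hle⟩, .inr ⟨l, rfl, le_max_right _ _⟩⟩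

lemma exitSide_complete {I : Option (ℝ × ℝ)} {o a : Option ℝ} {t : ℝ}
    (hI : ∃ J ∈ I, t ∈ Icc J.1 J.2) (h : a.isSome ∨ ∃ l ∈ o, l ≤ t) :
    ∃ x ≤ t, (exitSide I o a).val = some x := by
  obtain ⟨J, rfl, ht⟩ := hI
  rw [exitSide_val, Option.bind_some]
  split_ifs with ha
  · exact ⟨J.1, ht.1, rfl⟩
  · obtain ⟨l, rfl, hl⟩ := h.resolve_left ha
    have hmax : max J.1 l ≤ t := max_le ht.1 hl
    exact ⟨max J.1 l, hmax, if_pos (hmax.trans ht.2)⟩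

/-! ### Reachable points -/

/-- The cell `[i, i + 1] × [j, j + 1]` of the parameter space. -/
def cell (i j : ℕ) : Set (ℝ × ℝ) :=
  Icc (i : ℝ) (i + 1) ×ˢ Icc (j : ℝ) (j + 1)

lemma swap_mem_cell {i j : ℕ} {z : ℝ × ℝ} : z.swap ∈ cell j i ↔ z ∈ cell i j :=
  and_comm

lemma MonoOnto.extend {f : ℝ → ℝ} {x u : ℝ} (hf : MonoOnto f 1 x) (hxu : x ≤ u) :
    MonoOnto (fun t => f (min (2 * t) 1) + max (2 * t - 1) 0 * (u - x)) 1 u := by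
  have hx := hf.nonneg_right zero_le_one
  have hmaps : MapsTo (fun t : ℝ => min (2 * t) 1) (Icc 0 1) (Icc 0 1) := fun t ht =>
    ⟨le_min (by linarith [ht.1]) zero_le_one, min_le_right _ _⟩
  have hmono : MonotoneOn (fun t => f (min (2 * t) 1) + max (2 * t - 1) 0 * (u - x)) (Icc 0 1) := by
    intro s hs t ht hst
    have hmul : max (2 * s - 1) 0 * (u - x) ≤ max (2 * t - 1) 0 * (u - x) := by
      have := sub_nonneg.mpr hxu
      gcongr
    have hmin : min (2 * s) 1 ≤ min (2 * t) 1 := by gcongr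
    exact add_le_add (hf.1 (hmaps hs) (hmaps ht) hmin) hmul
  have hcont : ContinuousOn (fun t => f (min (2 * t) 1) + max (2 * t - 1) 0 * (u - x))
      (Icc 0 1) := by
    have := (hf.continuousOn hx).comp (by fun_prop) hmaps
    exact this.add (by fun_prop)
  have h := of_continuousOn zero_le_one hmono hcont (by norm_num [hf.map_zero hx])
  rw [show f (min (2 * 1) 1) + max (2 * 1 - 1) 0 * (u - x) = u by norm_num [hf.map_right hx]] at h
  exact h

namespace Curve

variable {d : ℕ} (P : Curve d)

/-- The number of edges, where a curve with one vertex counts as having one edge. -/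
def edges : ℕ := max P.size 2 - 1

lemma edges_pos : 0 < P.edges := by unfold edges; omega

lemma edges_le_size : P.edges ≤ P.size := by
  have := P.size_pos
  unfold edges; omega

lemma lt_edges_iff {i : ℕ} : i + 1 < P.edges ↔ i + 2 < P.size := by
  unfold edges; omega

lemma size_sub_one_le_succ {i : ℕ} (h : ¬ i + 2 < P.size) : (P.size : ℝ) - 1 ≤ i + 1 := by
  rw [not_lt, ← Nat.cast_le (α := ℝ)] at h
  push_cast at h
  linarith

lemma succ_le_size_sub_one {i : ℕ} (h : i + 2 < P.size) : (i : ℝ) + 1 ≤ P.size - 1 := by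
  rw [Nat.lt_iff_add_one_le, ← Nat.cast_le (α := ℝ)] at h
  push_cast at h
  linarith

lemma eval_lineMap {i : ℕ} {x u t : ℝ} (hx : x ∈ Icc (i : ℝ) (i + 1)) (hu : u ∈ Icc (i : ℝ) (i + 1))
    (ht : t ∈ Icc (0 : ℝ) 1) :
    P.eval (AffineMap.lineMap x u t) = AffineMap.lineMap (P.eval x) (P.eval u) t := by
  rw [P.eval_eq_lineMap ((convex_Icc _ _).lineMap_mem hx hu ht), P.eval_eq_lineMap hx,
    P.eval_eq_lineMap hu]
  simp only [AffineMap.lineMap_apply_module, smul_eq_mul]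
  module

end Curve

namespace Matched

variable {d : ℕ} {S T : Curve d} {x y u v δ : ℝ}

lemma dist_le (h : Matched S T x y δ) : dist (S.eval x) (T.eval y) ≤ δ := by
  obtain ⟨f, g, hf, hg, h⟩ := h
  have hend := h 1 (right_mem_Icc.mpr zero_le_one)
  rwa [hf.map_right (hf.nonneg_right zero_le_one), hg.map_right (hg.nonneg_right zero_le_one)]
    at hend

lemma nonneg_left (h : Matched S T x y δ) : 0 ≤ x :=
  let ⟨_, _, hf, _⟩ := h
  hf.nonneg_right zero_le_one

lemma zero (h : dist (S.eval 0) (T.eval 0) ≤ δ) : Matched S T 0 0 δ := by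
  have hconst : MonoOnto (fun t => 0 * t) 1 0 := .mul_left le_rfl
  exact ⟨_, _, hconst, hconst, fun t _ => by simpa only [zero_mul] using h⟩

lemma extend {i j : ℕ} (h : Matched S T x y δ) (hz : (x, y) ∈ cell i j) (hw : (u, v) ∈ cell i j)
    (hle : (x, y) ≤ (u, v)) (hd : dist (S.eval u) (T.eval v) ≤ δ) : Matched S T u v δ := by
  have hxy := h.dist_le
  obtain ⟨f, g, hf, hg, h⟩ := h
  refine ⟨_, _, hf.extend hle.1, hg.extend hle.2, fun t ht => ?_⟩
  rcases le_total (2 * t) 1 with hfirst | hsecond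
  · simpa only [min_eq_left hfirst, max_eq_right (sub_nonpos.mpr hfirst), zero_mul, add_zero]
      using h (2 * t) ⟨by linarith [ht.1], hfirst⟩
  · have hs : 2 * t - 1 ∈ Icc (0 : ℝ) 1 := ⟨sub_nonneg.mpr hsecond, by linarith [ht.2]⟩
    have hline : ∀ a b : ℝ, a + (2 * t - 1) * (b - a) = AffineMap.lineMap a b (2 * t - 1) := by
      intro a b
      rw [AffineMap.lineMap_apply_module', smul_eq_mul, add_comm]
    simp only [min_eq_right hsecond, max_eq_left hs.1]
    rw [hf.map_right (hf.nonneg_right zero_le_one), hg.map_right (hg.nonneg_right zero_le_one),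
      hline, hline, S.eval_lineMap hz.1 hw.1 hs, T.eval_lineMap hz.2 hw.2 hs]
    exact dist_lineMap_lineMap_le hxy hd hs

lemma clip_left (h : Matched S T x y δ) : Matched S T (min x (S.size - 1)) y δ := by
  have hx := h.nonneg_left
  obtain ⟨f, g, hf, hg, h⟩ := h
  have hclip := MonoOnto.min_right (le_min hx S.size_sub_one_nonneg) (min_le_left x (S.size - 1))
  refine ⟨_, g, hclip.comp hf, hg, fun t ht => ?_⟩
  rw [Function.comp_apply, ← min_assoc, min_eq_left (hf.mapsTo ht).2, S.eval_min_size]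
  exact h t ht

lemma of_size_le (h : Matched S T x y δ) (hx : S.size - 1 ≤ x) (hy : T.size - 1 ≤ y) :
    Matched S T (S.size - 1) (T.size - 1) δ := by
  have hclip := h.clip_left.symm.clip_left.symm
  rwa [min_eq_right hx, min_eq_right hy] at hclip

end Matched

/-! ### The exploration of the reachable cells -/

namespace Entry

variable {d : ℕ} {S T : Curve d} {δ : ℝ} {e : Entry} {x : ℝ} {z w : ℝ × ℝ}

/-- The record that corresponds to `e` if the two curves are exchanged. -/
def swap (e : Entry) : Entry :=
  ⟨e.j, e.i, e.bottom, e.left⟩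

/-- The points of the parameter space that a record holds. -/
def points (e : Entry) : Set (ℝ × ℝ) :=
  {p | (p.1 = e.i ∧ ∃ l ∈ e.left, p.2 = e.j + l) ∨ (p.2 = e.j ∧ ∃ b ∈ e.bottom, p.1 = e.i + b)}

/-- The point `z` of the cell of `e` lies above and to the right of a point of the record `e`. -/
def Covers (e : Entry) (z : ℝ × ℝ) : Prop :=
  z ∈ cell e.i e.j ∧ ∃ p ∈ e.points, p ≤ z

/-- The record belongs to a cell of the parameter space and holds reachable points of it. -/
structure IsSound (S T : Curve d) (δ : ℝ) (e : Entry) : Prop where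
  i_lt : e.i < S.edges
  j_lt : e.j < T.edges
  mem_cell : e.points ⊆ cell e.i e.j
  matched : ∀ p ∈ e.points, Matched S T p.1 p.2 δ

lemma swap_mem_points : z.swap ∈ e.swap.points ↔ z ∈ e.points :=
  or_comm

lemma fst_eq_or_snd_eq (h : z ∈ e.points) : z.1 = e.i ∨ z.2 = e.j :=
  h.imp And.left And.left

lemma mem_points_of_left {l : ℝ} (h : l ∈ e.left) : ((e.i : ℝ), e.j + l) ∈ e.points :=
  .inl ⟨rfl, l, h, rfl⟩

lemma mem_points_of_bottom {b : ℝ} (h : b ∈ e.bottom) : (e.i + b, (e.j : ℝ)) ∈ e.points :=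
  .inr ⟨rfl, b, h, rfl⟩

lemma mem_points_above {i j : ℕ} : z ∈ points ⟨i, j, none, some x⟩ ↔ z = (i + x, (j : ℝ)) := by
  simp [points, Prod.ext_iff, and_comm]

lemma Covers.mono (h : e.Covers z) (hzw : z ≤ w) (hw : w ∈ cell e.i e.j) : e.Covers w :=
  ⟨hw, h.2.imp fun _ hp => ⟨hp.1, hp.2.trans hzw⟩⟩

lemma Covers.swap (h : e.Covers z) : e.swap.Covers z.swap :=
  let ⟨hz, p, hp, hpz⟩ := h
  ⟨swap_mem_cell.mpr hz, p.swap, swap_mem_points.mpr hp, hpz.2, hpz.1⟩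

lemma IsSound.swap (h : e.IsSound S T δ) : e.swap.IsSound T S δ where
  i_lt := h.j_lt
  j_lt := h.i_lt
  mem_cell _ hp := swap_mem_cell.mp (h.mem_cell (swap_mem_points.mp hp))
  matched p hp := (h.matched p.swap (swap_mem_points.mp hp)).symm

lemma IsSound.matched_of_covers (h : e.IsSound S T δ) (hz : e.Covers z)
    (hd : dist (S.eval z.1) (T.eval z.2) ≤ δ) : Matched S T z.1 z.2 δ :=
  let ⟨hcell, p, hp, hpz⟩ := hz
  (h.matched p hp).extend (h.mem_cell hp) hcell hpz hd

end Entry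

section Successors

variable {d : ℕ} {S T : Curve d} {δ : ℝ} {e b : Entry} {x : ℝ} {z : ℝ × ℝ}

/-- The lowest reachable point of the top side of the cell of `e`, unless the cell is in the last
row. -/
noncomputable def topExit (S T : Curve d) (δ : ℝ) (e : Entry) : Option ℝ :=
  if e.j + 2 < T.size then
    (exitSide (freeInterval δ (T.vertex (e.j + 1)) (S.vertex e.i) (S.vertex (e.i + 1))).val
      e.bottom e.left).val
  else none

/-- The lowest reachable point of the right side of the cell of `e`, unless the cell is in the last
column. -/
noncomputable def rightExit (S T : Curve d) (δ : ℝ) (e : Entry) : Option ℝ :=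
  topExit T S δ e.swap

/-- The records that the exploration of the cell of `e` appends to the queue. -/
noncomputable def successors (S T : Curve d) (δ : ℝ) (e : Entry) : List Entry :=
  ((topExit S T δ e).map fun x => ⟨e.i, e.j + 1, none, some x⟩).toList ++
    ((rightExit S T δ e).map fun y => ⟨e.i + 1, e.j, some y, none⟩).toList

lemma mem_successors : b ∈ successors S T δ e ↔
    (∃ x, topExit S T δ e = some x ∧ ⟨e.i, e.j + 1, none, some x⟩ = b) ∨
      ∃ y, rightExit S T δ e = some y ∧ ⟨e.i + 1, e.j, some y, none⟩ = b := by
  simp only [successors, List.mem_append, Option.mem_toList, Option.map_eq_some_iff]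

lemma swap_mem_successors (h : b ∈ successors S T δ e) : b.swap ∈ successors T S δ e.swap := by
  rcases mem_successors.mp h with ⟨x, hx, rfl⟩ | ⟨y, hy, rfl⟩
  · exact mem_successors.mpr (.inr ⟨x, hx, rfl⟩)
  · exact mem_successors.mpr (.inl ⟨y, hy, rfl⟩)

lemma mem_unitInterval_and_dist_le_iff {i : ℕ} (P : Curve d) (s : Pt d) (t : ℝ) :
    t ∈ Icc (0 : ℝ) 1 ∧ dist (AffineMap.lineMap (P.vertex i) (P.vertex (i + 1)) t) s ≤ δ ↔
      i + t ∈ Icc (i : ℝ) (i + 1) ∧ dist (P.eval (i + t)) s ≤ δ := by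
  have hmem : i + t ∈ Icc (i : ℝ) (i + 1) ↔ t ∈ Icc (0 : ℝ) 1 := by simp
  rw [hmem]
  refine and_congr_right fun ht => ?_
  rw [P.eval_eq_lineMap (hmem.mpr ht), add_sub_cancel_left]

lemma topExit_sound (hδ : 0 ≤ δ) (he : e.points ⊆ cell e.i e.j) (h : topExit S T δ e = some x) :
    e.j + 2 < T.size ∧ e.Covers (e.i + x, (e.j + 1 : ℕ)) ∧
      dist (S.eval (e.i + x)) (T.eval (e.j + 1 : ℕ)) ≤ δ := by
  rw [topExit] at h
  split_ifs at h with hT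
  obtain ⟨hx, hentry⟩ := exitSide_sound (fun _ => fst_le_snd_of_mem_freeInterval) h
  rw [exists_mem_freeInterval_iff hδ, mem_unitInterval_and_dist_le_iff] at hx
  have hcell : (e.i + x, ((e.j + 1 : ℕ) : ℝ)) ∈ cell e.i e.j := ⟨hx.1, by simp⟩
  refine ⟨hT, ⟨hcell, ?_⟩, by simpa only [T.eval_natCast] using hx.2⟩
  rcases hentry with hleft | ⟨b, hb, hbx⟩
  · obtain ⟨l, hl⟩ := Option.isSome_iff_exists.mp hleft
    have hp := Entry.mem_points_of_left hl
    refine ⟨_, hp, hx.1.1, ?_⟩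
    simpa only [Nat.cast_succ] using (he hp).2.2
  · exact ⟨_, Entry.mem_points_of_bottom hb, add_le_add_right hbx _, by simp⟩

lemma exists_successor_covers_of_top (hδ : 0 ≤ δ) (hc : e.Covers z) (htop : z.2 = e.j + 1)
    (hT : e.j + 2 < T.size) (hd : dist (S.eval z.1) (T.eval z.2) ≤ δ) :
    ∃ b ∈ successors S T δ e, b.Covers z := by
  obtain ⟨hcell, p, hp, hpz⟩ := hc
  have hinterval : ∃ I ∈ (freeInterval δ (T.vertex (e.j + 1)) (S.vertex e.i)
      (S.vertex (e.i + 1))).val, z.1 - e.i ∈ Icc I.1 I.2 := by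
    rw [exists_mem_freeInterval_iff hδ, mem_unitInterval_and_dist_le_iff, add_sub_cancel,
      ← T.eval_natCast, Nat.cast_succ, ← htop]
    exact ⟨hcell.1, hd⟩
  have hentry : e.left.isSome ∨ ∃ l ∈ e.bottom, l ≤ z.1 - e.i := by
    rcases hp with ⟨-, l, hl, -⟩ | ⟨-, b, hb, hpb⟩
    · exact .inl (Option.isSome_of_mem hl)
    · exact .inr ⟨b, hb, by linarith [hpz.1]⟩
  obtain ⟨t, htz, ht⟩ := exitSide_complete hinterval hentry
  have hexit : topExit S T δ e = some t := by rw [topExit, if_pos hT, ht]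
  refine ⟨_, mem_successors.mpr (.inl ⟨t, hexit, rfl⟩), ⟨hcell.1, by simp [htop]⟩, _,
    Entry.mem_points_above.mpr rfl, le_sub_iff_add_le'.mp htz, by simp [htop]⟩

lemma exists_successor_covers_of_right (hδ : 0 ≤ δ) (hc : e.Covers z) (hright : z.1 = e.i + 1)
    (hS : e.i + 2 < S.size) (hd : dist (S.eval z.1) (T.eval z.2) ≤ δ) :
    ∃ b ∈ successors S T δ e, b.Covers z := by
  obtain ⟨b, hb, hbz⟩ := exists_successor_covers_of_top (S := T) (T := S) hδ hc.swap hright hS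
    (by rwa [dist_comm])
  exact ⟨b.swap, swap_mem_successors hb, hbz.swap⟩

namespace Entry

lemma IsSound.above (hδ : 0 ≤ δ) (he : e.IsSound S T δ) (h : topExit S T δ e = some x) :
    IsSound S T δ ⟨e.i, e.j + 1, none, some x⟩ := by
  obtain ⟨hT, hcovers, hd⟩ := topExit_sound hδ he.mem_cell h
  refine ⟨he.i_lt, T.lt_edges_iff.mpr hT, fun p hp => ?_, fun p hp => ?_⟩
  · rw [mem_points_above.mp hp]
    exact ⟨hcovers.1.1, by simp⟩
  · rw [mem_points_above.mp hp]
    exact he.matched_of_covers hcovers hd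

lemma IsSound.successor (hδ : 0 ≤ δ) (he : e.IsSound S T δ) (hb : b ∈ successors S T δ e) :
    b.IsSound S T δ := by
  rcases mem_successors.mp hb with ⟨x, hx, rfl⟩ | ⟨y, hy, rfl⟩
  · exact he.above hδ hx
  · exact (he.swap.above hδ hy).swap

end Entry

end Successors

/-! ### The order of the queue -/

namespace Entry

/-- The cell of `b` comes strictly after that of `a` in the order of the exploration. -/
def CellLT (a b : Entry) : Prop :=
  a.i + a.j < b.i + b.j ∨ (a.i + a.j = b.i + b.j ∧ a.i < b.i)

/-- The order of the records in the queue: of two records of a cell, the one for its left side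
comes first. -/
def Precedes (a b : Entry) : Prop :=
  a.CellLT b ∨ (a.i = b.i ∧ a.j = b.j ∧ a.bottom = none ∧ b.left = none)

end Entry

/-- The invariant of the queue. By its last part, the records that the exploration of a queued
cell appends come after all those that are already there. -/
structure QueueOrdered (q : List Entry) : Prop where
  pairwise : q.Pairwise Entry.Precedes
  nonempty : ∀ a ∈ q, a.points.Nonempty
  precedes_above : ∀ a ∈ q, ∀ b ∈ q, b.Precedes ⟨a.i, a.j + 1, none, none⟩

/-- What is left of the ordered queue `e :: q` if its first cell is taken: `c` joins the records of
this cell, and `q'` holds the other ones. -/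
structure PopSpec (e : Entry) (q : List Entry) (c : Entry) (q' : List Entry) : Prop where
  i_eq : c.i = e.i
  j_eq : c.j = e.j
  sublist : q'.Sublist q
  cell_lt : ∀ b ∈ q', c.CellLT b
  nonempty : c.points.Nonempty
  exists_of_mem_points : ∀ p ∈ c.points, ∃ b ∈ e :: q, b.i = c.i ∧ b.j = c.j ∧ p ∈ b.points
  mem_or_covers : ∀ b ∈ e :: q, b ∈ q' ∨ ∀ z, b.Covers z → c.Covers z

lemma popSpec_of_cellLT {e : Entry} {q : List Entry} (he : e.points.Nonempty)
    (h : ∀ b ∈ q, e.CellLT b) : PopSpec e q e q where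
  i_eq := rfl
  j_eq := rfl
  sublist := .refl _
  cell_lt := h
  nonempty := he
  exists_of_mem_points _ hp := ⟨e, List.mem_cons_self, rfl, rfl, hp⟩
  mem_or_covers _ hb := (List.mem_cons.mp hb).symm.imp_right fun h _ => by rw [h]; exact id

lemma popSpec_merge {e e' : Entry} {q : List Entry} (he : e.points.Nonempty) (hi : e.i = e'.i)
    (hj : e.j = e'.j) (hbottom : e.bottom = none) (hleft : e'.left = none)
    (h : ∀ b ∈ q, e.CellLT b) :
    PopSpec e (e' :: q) ⟨e.i, e.j, e.left.or e'.left, e.bottom.or e'.bottom⟩ q := by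
  have hpoints : Entry.points ⟨e.i, e.j, e.left.or e'.left, e.bottom.or e'.bottom⟩ =
      e.points ∪ e'.points := by
    ext p
    simp [Entry.points, hbottom, hleft, hi, hj]
  have hcovers : ∀ b : Entry, b.i = e.i → b.j = e.j → b.points ⊆ e.points ∪ e'.points →
      ∀ z, b.Covers z → Entry.Covers ⟨e.i, e.j, e.left.or e'.left, e.bottom.or e'.bottom⟩ z := by
    rintro b hbi hbj hsub z ⟨hz, p, hp, hpz⟩
    exact ⟨hbi ▸ hbj ▸ hz, p, hpoints ▸ hsub hp, hpz⟩
  refine ⟨rfl, rfl, List.sublist_cons_self _ _, h, ?_, fun p hp => ?_, fun b hb => ?_⟩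
  · exact hpoints ▸ he.inl
  · rcases hpoints ▸ hp with hp | hp
    · exact ⟨e, by simp, rfl, rfl, hp⟩
    · exact ⟨e', by simp, hi.symm, hj.symm, hp⟩
  · rcases List.mem_cons.mp hb with rfl | hb
    · exact .inr (hcovers b rfl rfl subset_union_left)
    rcases List.mem_cons.mp hb with rfl | hb
    · exact .inr (hcovers b hi.symm hj.symm subset_union_right)
    · exact .inl hb

lemma popCell_cons_val (e e' : Entry) (q : List Entry) : (popCell e (e' :: q)).val =
    if e.i = e'.i ∧ e.j = e'.j then (⟨e.i, e.j, e.left.or e'.left, e.bottom.or e'.bottom⟩, q)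
    else (e, e' :: q) := by
  simp only [popCell, op_bind_val, apply_ite Timed.val, op_val, Bool.and_eq_true,
    decide_eq_true_eq]

lemma Entry.CellLT.trans_precedes {a b c : Entry} (hab : a.CellLT b) (hbc : b.Precedes c) :
    a.CellLT c := by
  unfold Entry.Precedes Entry.CellLT at *
  omega

theorem popCell_spec {e : Entry} {q : List Entry} (h : QueueOrdered (e :: q)) :
    PopSpec e q (popCell e q).val.1 (popCell e q).val.2 := by
  have he := h.nonempty e List.mem_cons_self
  rcases q with _ | ⟨e', q⟩
  · exact popSpec_of_cellLT he (by simp)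
  have hpairwise := h.pairwise
  simp only [List.pairwise_cons, List.forall_mem_cons] at hpairwise
  obtain ⟨⟨hee', -⟩, he', -⟩ := hpairwise
  rw [popCell_cons_val]
  split_ifs with hsame
  · have hnot : ¬ e.CellLT e' := by unfold Entry.CellLT; omega
    obtain ⟨-, -, hbottom, hleft⟩ := hee'.resolve_left hnot
    refine popSpec_merge he hsame.1 hsame.2 hbottom hleft fun b hb => ?_
    obtain ⟨p, hp⟩ := h.nonempty e' (by simp)
    rcases he' b hb with hlt | ⟨-, -, hbottom', -⟩
    · unfold Entry.CellLT at *
      omega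
    · simp [Entry.points, hleft, hbottom'] at hp
  · have hlt : e.CellLT e' := hee'.resolve_right fun hr => hsame ⟨hr.1, hr.2.1⟩
    exact popSpec_of_cellLT he (List.forall_mem_cons.mpr
      ⟨hlt, fun b hb => hlt.trans_precedes (he' b hb)⟩)

section Queue

variable {d : ℕ} {S T : Curve d} {δ : ℝ} {e b c : Entry} {q q' : List Entry}

lemma cellLT_of_mem_successors (h : b ∈ successors S T δ e) : e.CellLT b := by
  rcases mem_successors.mp h with ⟨x, -, rfl⟩ | ⟨y, -, rfl⟩ <;> left <;> simp only <;> omega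

lemma points_nonempty_of_mem_successors (h : b ∈ successors S T δ e) : b.points.Nonempty := by
  rcases mem_successors.mp h with ⟨x, -, rfl⟩ | ⟨y, -, rfl⟩
  · exact ⟨_, Entry.mem_points_of_bottom rfl⟩
  · exact ⟨_, Entry.mem_points_of_left rfl⟩

lemma pairwise_successors (e : Entry) : (successors S T δ e).Pairwise Entry.Precedes := by
  unfold successors
  rcases topExit S T δ e with _ | x <;> rcases rightExit S T δ e with _ | y <;>
    simp [Entry.Precedes, Entry.CellLT]
  omega

lemma Entry.Precedes.of_mem_successors (h : b.Precedes ⟨e.i, e.j + 1, none, none⟩)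
    {s : Entry} (hs : s ∈ successors S T δ e) : b.Precedes s := by
  rcases mem_successors.mp hs with ⟨x, -, rfl⟩ | ⟨y, -, rfl⟩
  · exact h
  · unfold Entry.Precedes Entry.CellLT at *
    dsimp only at *
    omega

lemma precedes_above_of_mem_successors (h : b ∈ successors S T δ e) {a : Entry}
    (ha : e.CellLT a) : b.Precedes ⟨a.i, a.j + 1, none, none⟩ := by
  unfold Entry.Precedes Entry.CellLT at *
  rcases mem_successors.mp h with ⟨x, -, rfl⟩ | ⟨y, -, rfl⟩ <;> simp <;> omega

lemma PopSpec.cell_lt_append (hp : PopSpec e q c q') (hb : b ∈ q' ++ successors S T δ c) :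
    c.CellLT b :=
  (List.mem_append.mp hb).elim (hp.cell_lt b) cellLT_of_mem_successors

lemma PopSpec.queueOrdered (hp : PopSpec e q c q') (h : QueueOrdered (e :: q)) :
    QueueOrdered (q' ++ successors S T δ c) := by
  have hsub : ∀ b ∈ q', b ∈ e :: q := fun b hb => List.mem_cons_of_mem _ (hp.sublist.subset hb)
  have hold : ∀ b ∈ q', b.Precedes ⟨c.i, c.j + 1, none, none⟩ := fun b hb => by
    simpa only [hp.i_eq, hp.j_eq] using h.precedes_above e List.mem_cons_self b (hsub b hb)
  refine ⟨?_, fun b hb => ?_, fun a ha b hb => ?_⟩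
  · have hq' := (List.pairwise_cons.mp h.pairwise).2.sublist hp.sublist
    exact List.pairwise_append.mpr ⟨hq', pairwise_successors c, fun b hb _ hs =>
      (hold b hb).of_mem_successors hs⟩
  · rcases List.mem_append.mp hb with hb | hb
    · exact h.nonempty b (hsub b hb)
    · exact points_nonempty_of_mem_successors hb
  · have hca := hp.cell_lt_append ha
    rcases List.mem_append.mp hb with hb | hb
    · have hbc := hold b hb
      unfold Entry.Precedes Entry.CellLT at *
      dsimp only at *
      omega
    · exact precedes_above_of_mem_successors hb hca

lemma PopSpec.isSound (hp : PopSpec e q c q') (h : ∀ b ∈ e :: q, b.IsSound S T δ) :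
    c.IsSound S T δ := by
  have he := h e List.mem_cons_self
  refine ⟨hp.i_eq ▸ he.i_lt, hp.j_eq ▸ he.j_lt, fun p hpc => ?_, fun p hpc => ?_⟩
  all_goals obtain ⟨b, hb, hi, hj, hpb⟩ := hp.exists_of_mem_points p hpc
  · exact hi ▸ hj ▸ (h b hb).mem_cell hpb
  · exact (h b hb).matched p hpb

lemma PopSpec.isSound_append (hp : PopSpec e q c q') (hδ : 0 ≤ δ)
    (h : ∀ b ∈ e :: q, b.IsSound S T δ) : ∀ b ∈ q' ++ successors S T δ c, b.IsSound S T δ := by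
  intro b hb
  rcases List.mem_append.mp hb with hb | hb
  · exact h b (List.mem_cons_of_mem _ (hp.sublist.subset hb))
  · exact (hp.isSound h).successor hδ hb

end Queue

/-! ### Running time and correctness of the exploration -/

section Explore

variable {d : ℕ} {S T : Curve d} {δ : ℝ} {e c : Entry} {q q' : List Entry} {k : ℕ}

lemma enqueue_val (q : List Entry) (lo : Option ℝ) (f : ℝ → Entry) :
    (enqueue q lo f).val = q ++ (lo.map f).toList := by
  cases lo <;> simp [enqueue]

lemma enqueue_steps (q : List Entry) (lo : Option ℝ) (f : ℝ → Entry) :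
    (enqueue q lo f).steps = 1 := by
  cases lo <;> rfl

lemma popCell_steps_le (e : Entry) (q : List Entry) : (popCell e q).steps ≤ 3 := by
  rcases q with _ | ⟨e', q⟩
  · simp [popCell]
  · simp only [popCell, op_bind_steps, apply_ite Timed.steps, op_steps]
    split_ifs <;> norm_num

lemma explore_cons_val (k : ℕ) (e : Entry) (q : List Entry) :
    (explore S T δ (k + 1) (e :: q)).val =
      if ¬ (popCell e q).val.1.i + 2 < S.size ∧ ¬ (popCell e q).val.1.j + 2 < T.size ∧
        dist (S.vertex ((popCell e q).val.1.i + 1)) (T.vertex ((popCell e q).val.1.j + 1)) ≤ δ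
      then Answer.yes
      else (explore S T δ k ((popCell e q).val.2 ++ successors S T δ (popCell e q).val.1)).val := by
  rw [explore, Timed.bind_val]
  generalize (popCell e q).val = c
  obtain ⟨c, q'⟩ := c
  by_cases hS : c.i + 2 < S.size <;> by_cases hT : c.j + 2 < T.size <;>
    by_cases hd : dist (S.vertex (c.i + 1)) (T.vertex (c.j + 1)) ≤ δ <;>
    simp [hS, hT, hd, successors, topExit, rightExit, enqueue_val, Entry.swap]

-- At most 3 steps take the cell, 6 read its data, `2 * (23 + 6)` find its exits, and 2 extend the
-- queue.
lemma explore_cons_steps_le {n : ℕ} (h : ∀ q, (explore S T δ k q).steps ≤ n) (e : Entry)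
    (q : List Entry) : (explore S T δ (k + 1) (e :: q)).steps ≤ 69 + n := by
  have hpop := popCell_steps_le e q
  rw [explore, Timed.bind_steps]
  generalize (popCell e q).val = c
  obtain ⟨c, q'⟩ := c
  have htop_free := freeInterval_steps_le δ (T.vertex (c.j + 1)) (S.vertex c.i) (S.vertex (c.i + 1))
  have htop_exit := exitSide_steps_le (freeInterval δ (T.vertex (c.j + 1)) (S.vertex c.i)
    (S.vertex (c.i + 1))).val c.bottom c.left
  have hright_free :=
    freeInterval_steps_le δ (S.vertex (c.i + 1)) (T.vertex c.j) (T.vertex (c.j + 1))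
  have hright_exit := exitSide_steps_le (freeInterval δ (S.vertex (c.i + 1)) (T.vertex c.j)
    (T.vertex (c.j + 1))).val c.left c.bottom
  by_cases hS : c.i + 2 < S.size <;> by_cases hT : c.j + 2 < T.size
  on_goal 4 =>
    have hq' := h q'
    by_cases hd : dist (S.vertex (c.i + 1)) (T.vertex (c.j + 1)) ≤ δ <;>
      simp [hS, hT, hd] <;> omega
  all_goals
    simp only [hS, hT, decide_true, decide_false, Bool.not_true, Bool.not_false,
      Bool.false_and, Bool.and_false, Bool.false_eq_true, if_false, if_true, Timed.bind_steps,
      enqueue_steps, op_steps, op_val]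
    generalize hE : explore S T δ k _ = E
    have hE_le : E.steps ≤ n := hE ▸ h _
    omega

lemma explore_steps_le (S T : Curve d) (δ : ℝ) (k : ℕ) (q : List Entry) :
    (explore S T δ k q).steps ≤ 69 * k + 1 := by
  induction k generalizing q with
  | zero => simp [explore]
  | succ k ih =>
    rcases q with _ | ⟨e, q⟩
    · simp [explore]
    · have := explore_cons_steps_le ih e q
      omega

lemma Entry.IsSound.matched_size_sub_one (hc : c.IsSound S T δ) (hne : c.points.Nonempty)
    (hi : ¬ c.i + 2 < S.size) (hj : ¬ c.j + 2 < T.size)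
    (hd : dist (S.vertex (c.i + 1)) (T.vertex (c.j + 1)) ≤ δ) :
    Matched S T (S.size - 1) (T.size - 1) δ := by
  obtain ⟨p, hp⟩ := hne
  obtain ⟨⟨-, hp_fst⟩, -, hp_snd⟩ := hc.mem_cell hp
  have hcorner : c.Covers ((c.i + 1 : ℕ), (c.j + 1 : ℕ)) :=
    ⟨⟨by simp, by simp⟩, p, hp, by simpa using hp_fst, by simpa using hp_snd⟩
  have hmatched := hc.matched_of_covers hcorner (by rwa [S.eval_natCast, T.eval_natCast])
  refine hmatched.of_size_le ?_ ?_ <;> push_cast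
  · exact S.size_sub_one_le_succ hi
  · exact T.size_sub_one_le_succ hj

theorem matched_of_explore_yes (hδ : 0 ≤ δ) (hq : QueueOrdered q) (hs : ∀ b ∈ q, b.IsSound S T δ)
    (h : (explore S T δ k q).val = Answer.yes) :
    Matched S T (S.size - 1) (T.size - 1) δ := by
  induction k generalizing q with
  | zero => simp [explore] at h
  | succ k ih =>
    rcases q with _ | ⟨e, q⟩
    · simp [explore] at h
    have hp := popCell_spec hq
    rw [explore_cons_val] at h
    split_ifs at h with hfinal
    · obtain ⟨hi, hj, hd⟩ := hfinal
      exact (hp.isSound hs).matched_size_sub_one hp.nonempty hi hj hd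
    · exact ih (hp.queueOrdered hq) (hp.isSound_append hδ hs) h

lemma MonoOnto.exists_ge_eq {f : ℝ → ℝ} {b t v : ℝ} (hf : MonoOnto f 1 b) (ht : t ∈ Icc 0 1)
    (htv : f t ≤ v) (hvb : v ≤ b) : ∃ s ∈ Icc t 1, f s = v := by
  have hb := hf.nonneg_right zero_le_one
  have hcont := (hf.continuousOn hb).mono (Icc_subset_Icc_left ht.1)
  exact intermediate_value_Icc ht.2 hcont ⟨htv, hvb.trans_eq (hf.map_right hb).symm⟩

lemma Matched.dist_vertex_le (h : Matched S T (S.size - 1) (T.size - 1) δ) {i j : ℕ}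
    (hi : ¬ i + 2 < S.size) (hj : ¬ j + 2 < T.size) :
    dist (S.vertex (i + 1)) (T.vertex (j + 1)) ≤ δ := by
  rw [S.vertex_of_size_le (by omega), T.vertex_of_size_le (by omega)]
  simpa only [S.eval_of_size_le le_rfl, T.eval_of_size_le le_rfl] using h.dist_le

section Exit

variable {f g : ℝ → ℝ} {t : ℝ} (hδ : 0 ≤ δ) (hf : MonoOnto f 1 (S.size - 1))
  (hg : MonoOnto g 1 (T.size - 1))
  (hd : ∀ t ∈ Icc (0 : ℝ) 1, dist (S.eval (f t)) (T.eval (g t)) ≤ δ)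

include hδ hf hg hd

lemma exists_time_at_right (ht : t ∈ Icc 0 1) (hc : c.Covers (f t, g t)) (hS : c.i + 2 < S.size) :
    ∃ s ∈ Icc 0 1, f s = c.i + 1 ∧
      (g s ≤ c.j + 1 → ∃ b ∈ successors S T δ c, b.Covers (f s, g s)) := by
  obtain ⟨s, hs, hfs⟩ := hf.exists_ge_eq ht hc.1.1.2 (S.succ_le_size_sub_one hS)
  have hs01 : s ∈ Icc (0 : ℝ) 1 := ⟨ht.1.trans hs.1, hs.2⟩
  have hgs := hg.1 ht hs01 hs.1
  refine ⟨s, hs01, hfs, fun hgj => ?_⟩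
  have hcovers : c.Covers (f s, g s) := hc.mono ⟨hf.1 ht hs01 hs.1, hgs⟩
    ⟨by simp [hfs], hc.1.2.1.trans hgs, hgj⟩
  exact exists_successor_covers_of_right hδ hcovers hfs hS (hd s hs01)

lemma exists_time_at_top (ht : t ∈ Icc 0 1) (hc : c.Covers (f t, g t)) (hT : c.j + 2 < T.size) :
    ∃ s ∈ Icc 0 1, g s = c.j + 1 ∧
      (f s ≤ c.i + 1 → ∃ b ∈ successors S T δ c, b.Covers (f s, g s)) := by
  obtain ⟨s, hs, hgs, h⟩ := exists_time_at_right (S := T) (T := S) hδ hg hf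
    (fun t ht => by rw [dist_comm]; exact hd t ht) ht hc.swap hT
  refine ⟨s, hs, hgs, fun hfs => ?_⟩
  obtain ⟨b, hb, hbs⟩ := h hfs
  exact ⟨b.swap, swap_mem_successors hb, hbs.swap⟩

lemma exists_successor_covers_of_covers (ht : t ∈ Icc 0 1) (hc : c.Covers (f t, g t))
    (hfinal : c.i + 2 < S.size ∨ c.j + 2 < T.size) :
    ∃ s ∈ Icc (0 : ℝ) 1, ∃ b ∈ successors S T δ c, b.Covers (f s, g s) := by
  have hg_le : ¬ c.j + 2 < T.size → ∀ s ∈ Icc (0 : ℝ) 1, g s ≤ c.j + 1 := fun hT s hs =>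
    (hg.mapsTo hs).2.trans (T.size_sub_one_le_succ hT)
  have hf_le : ¬ c.i + 2 < S.size → ∀ s ∈ Icc (0 : ℝ) 1, f s ≤ c.i + 1 := fun hS s hs =>
    (hf.mapsTo hs).2.trans (S.size_sub_one_le_succ hS)
  by_cases hS : c.i + 2 < S.size
  · obtain ⟨s, hs, hfs, hright⟩ := exists_time_at_right hδ hf hg hd ht hc hS
    by_cases hT : c.j + 2 < T.size
    · obtain ⟨s', hs', hgs', htop⟩ := exists_time_at_top hδ hf hg hd ht hc hT
      rcases le_total s s' with hss' | hss'
      · exact ⟨s, hs, hright ((hg.1 hs hs' hss').trans_eq hgs')⟩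
      · exact ⟨s', hs', htop ((hf.1 hs' hs hss').trans_eq hfs)⟩
    · exact ⟨s, hs, hright (hg_le hT s hs)⟩
  · obtain ⟨s, hs, -, htop⟩ :=
      exists_time_at_top hδ hf hg hd ht hc (hfinal.resolve_left hS)
    exact ⟨s, hs, htop (hf_le hS s hs)⟩

lemma explore_ne_no (hq : QueueOrdered q) (ht : t ∈ Icc 0 1) {b : Entry} (hb : b ∈ q)
    (hcovers : b.Covers (f t, g t)) : (explore S T δ k q).val ≠ Answer.no := by
  induction k generalizing q b t with
  | zero => simp [explore]
  | succ k ih =>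
    rcases q with _ | ⟨e, q⟩
    · simp at hb
    have hp := popCell_spec hq
    have hq' := hp.queueOrdered (S := S) (T := T) (δ := δ) hq
    rw [explore_cons_val]
    split_ifs with hfinal
    · nofun
    rcases hp.mem_or_covers b hb with hbq | hc
    · exact ih hq' ht (List.mem_append_left _ hbq) hcovers
    · have hexit : (popCell e q).val.1.i + 2 < S.size ∨ (popCell e q).val.1.j + 2 < T.size := by
        by_contra! hno
        exact hfinal ⟨hno.1.not_gt, hno.2.not_gt,
          Matched.dist_vertex_le ⟨f, g, hf, hg, hd⟩ hno.1.not_gt hno.2.not_gt⟩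
      obtain ⟨s, hs, b', hb', hcovers'⟩ :=
        exists_successor_covers_of_covers hδ hf hg hd ht (hc _ hcovers) hexit
      exact ih hq' hs (List.mem_append_right _ hb') hcovers'

end Exit

/-- The cell `p` has a reachable point on its left or on its bottom side. -/
def ReachableCell (S T : Curve d) (δ : ℝ) (p : ℕ × ℕ) : Prop :=
  p.1 < S.edges ∧ p.2 < T.edges ∧
    ∃ z ∈ cell p.1 p.2, (z.1 = p.1 ∨ z.2 = p.2) ∧ Matched S T z.1 z.2 δ

lemma ReachableCell.swap {p : ℕ × ℕ} (h : ReachableCell S T δ p) : ReachableCell T S δ p.swap :=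
  let ⟨hi, hj, z, hz, hside, hmatched⟩ := h
  ⟨hj, hi, z.swap, swap_mem_cell.mpr hz, hside.symm, hmatched.symm⟩

lemma Entry.IsSound.reachableCell (hc : c.IsSound S T δ) (hne : c.points.Nonempty) :
    ReachableCell S T δ (c.i, c.j) :=
  let ⟨p, hp⟩ := hne
  ⟨hc.i_lt, hc.j_lt, p, hc.mem_cell hp, Entry.fst_eq_or_snd_eq hp, hc.matched p hp⟩

theorem exists_reachableCells_of_explore_timeout (hδ : 0 ≤ δ) (hq : QueueOrdered q)
    (hs : ∀ b ∈ q, b.IsSound S T δ) (h : (explore S T δ k q).val = Answer.timeout) :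
    ∃ A : Finset (ℕ × ℕ), A.card = k ∧ ∀ p ∈ A, ReachableCell S T δ p ∧
      ∃ b ∈ q, b.i + b.j < p.1 + p.2 ∨ (b.i + b.j = p.1 + p.2 ∧ b.i ≤ p.1) := by
  induction k generalizing q with
  | zero => exact ⟨∅, rfl, by simp⟩
  | succ k ih =>
    rcases q with _ | ⟨e, q⟩
    · simp [explore] at h
    have hp := popCell_spec hq
    rw [explore_cons_val] at h
    set c := (popCell e q).val.1
    split_ifs at h
    obtain ⟨A, hA, hA'⟩ := ih (hp.queueOrdered hq) (hp.isSound_append hδ hs) h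
    have hlt : ∀ p ∈ A, c.i + c.j < p.1 + p.2 ∨ (c.i + c.j = p.1 + p.2 ∧ c.i < p.1) := by
      intro p hpA
      obtain ⟨-, b, hb, hbp⟩ := hA' p hpA
      have hcb := hp.cell_lt_append hb
      unfold Entry.CellLT at hcb
      omega
    have hnot : (c.i, c.j) ∉ A := fun hmem => by simpa using hlt _ hmem
    refine ⟨insert (c.i, c.j) A, by rw [Finset.card_insert_of_notMem hnot, hA], ?_⟩
    rw [Finset.forall_mem_insert]
    refine ⟨⟨(hp.isSound hs).reachableCell hp.nonempty, e, List.mem_cons_self, ?_⟩,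
      fun p hpA => ⟨(hA' p hpA).1, e, List.mem_cons_self, ?_⟩⟩
    · exact .inr ⟨by rw [hp.i_eq, hp.j_eq], hp.i_eq.ge⟩
    · have hce := hlt p hpA
      rw [hp.i_eq, hp.j_eq] at hce
      omega

lemma startQueue_val (S T : Curve d) (δ : ℝ) : (startQueue S T δ).val =
    if dist (S.vertex 0) (T.vertex 0) ≤ δ then [⟨0, 0, some 0, some 0⟩] else [] := by
  simp only [startQueue, op_bind_val, apply_ite Timed.val, op_val, decide_eq_true_eq]

lemma startQueue_steps (S T : Curve d) (δ : ℝ) : (startQueue S T δ).steps = 5 := by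
  simp only [startQueue, op_bind_steps, apply_ite Timed.steps, op_steps, ite_self]

lemma queueOrdered_startQueue : QueueOrdered (startQueue S T δ).val := by
  rw [startQueue_val]
  split_ifs
  · refine ⟨by simp, ?_, ?_⟩
    · simpa using ⟨_, Entry.mem_points_of_left rfl⟩
    · simp [Entry.Precedes, Entry.CellLT]
  · exact ⟨by simp, by simp, by simp⟩

lemma isSound_startQueue : ∀ b ∈ (startQueue S T δ).val, b.IsSound S T δ := by
  rw [startQueue_val]
  split_ifs with hd
  · have hpoints : ∀ p ∈ Entry.points ⟨0, 0, some 0, some 0⟩, p = (0, 0) := by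
      rintro p (⟨hi, -, ⟨⟩, hj⟩ | ⟨hj, -, ⟨⟩, hi⟩) <;> simp_all [Prod.ext_iff]
    have hmatched : Matched S T 0 0 δ := .zero (by
      rwa [← Nat.cast_zero, S.eval_natCast, T.eval_natCast])
    rw [List.forall_mem_singleton]
    refine ⟨S.edges_pos, T.edges_pos, fun p hp => ?_, fun p hp => ?_⟩ <;> rw [hpoints p hp]
    · simp [cell]
    · exact hmatched
  · simp

theorem explore_startQueue_ne_no (hδ : 0 ≤ δ) (h : Matched S T (S.size - 1) (T.size - 1) δ) :
    (explore S T δ k (startQueue S T δ).val).val ≠ Answer.no := by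
  obtain ⟨f, g, hf, hg, hd⟩ := h
  have h0 : (0 : ℝ) ∈ Icc (0 : ℝ) 1 := left_mem_Icc.mpr zero_le_one
  have hf0 := hf.map_zero S.size_sub_one_nonneg
  have hg0 := hg.map_zero T.size_sub_one_nonneg
  have hstart := hd 0 h0
  rw [hf0, hg0, ← Nat.cast_zero, S.eval_natCast, T.eval_natCast] at hstart
  refine explore_ne_no hδ hf hg hd queueOrdered_startQueue h0 (b := ⟨0, 0, some 0, some 0⟩) ?_ ?_
  · simp [startQueue_val, hstart]
  · rw [hf0, hg0]
    exact ⟨by simp [cell], _, Entry.mem_points_of_left rfl, by simp⟩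

end Explore

/-! ### Counting the reachable cells -/

section Counting

lemma card_le_mul_of_card_rows_le {A : Finset (ℕ × ℕ)} {n : ℕ} {b : ℝ} (hn : ∀ p ∈ A, p.2 < n)
    (hb : ∀ (j : ℕ) (B : Finset ℕ), (∀ i ∈ B, (i, j) ∈ A) → (B.card : ℝ) ≤ b) :
    (A.card : ℝ) ≤ n * b := by
  have hrow : ∀ j, ((A.filter fun p => p.2 = j).card : ℝ) ≤ b := fun j => by
    have hinj : InjOn Prod.fst (A.filter fun p => p.2 = j : Set (ℕ × ℕ)) := fun p hp q hq hpq =>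
      Prod.ext hpq ((Finset.mem_filter.mp hp).2.trans (Finset.mem_filter.mp hq).2.symm)
    rw [← Finset.card_image_of_injOn hinj]
    refine hb j _ fun i hi => ?_
    obtain ⟨p, hp, rfl⟩ := Finset.mem_image.mp hi
    obtain ⟨hpA, rfl⟩ := Finset.mem_filter.mp hp
    exact hpA
  rw [Finset.card_eq_sum_card_fiberwise (f := Prod.snd) (t := Finset.range n)
    fun p hp => Finset.mem_coe.mpr (Finset.mem_range.mpr (hn p hp)), Nat.cast_sum]
  simpa only [Finset.card_range, nsmul_eq_mul] using
    Finset.sum_le_card_nsmul (Finset.range n) _ b fun j _ => hrow j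

lemma card_le_mul_of_card_columns_le {A : Finset (ℕ × ℕ)} {n : ℕ} {b : ℝ}
    (hn : ∀ p ∈ A, p.1 < n)
    (hb : ∀ (i : ℕ) (B : Finset ℕ), (∀ j ∈ B, (i, j) ∈ A) → (B.card : ℝ) ≤ b) :
    (A.card : ℝ) ≤ n * b := by
  rw [← Finset.card_map (Equiv.prodComm ℕ ℕ).toEmbedding]
  refine card_le_mul_of_card_rows_le (Finset.forall_mem_map.mpr hn) fun i B hB =>
    hb i B fun j hj => ?_
  simpa using hB j hj

lemma card_mul_le_of_increments {H : ℕ → ℝ} {J : ℕ} {s : ℝ} {B : Finset ℕ}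
    (hmono : ∀ j < J, H j ≤ H (j + 1)) (hB : ∀ j ∈ B, j < J ∧ s ≤ H (j + 1) - H j) :
    B.card * s ≤ H J - H 0 := by
  rw [← nsmul_eq_mul, ← Finset.sum_range_sub H J]
  refine (Finset.card_nsmul_le_sum B _ s fun j hj => (hB j hj).2).trans ?_
  exact Finset.sum_le_sum_of_subset_of_nonneg (fun j hj => Finset.mem_range.mpr (hB j hj).1)
    fun j hj _ => sub_nonneg.mpr (hmono j (Finset.mem_range.mp hj))

lemma MonoOnto.exists_monotoneOn_rightInvOn {f : ℝ → ℝ} {a b : ℝ} (h : MonoOnto f a b) :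
    ∃ τ : ℝ → ℝ, MonotoneOn τ (Icc 0 b) ∧ MapsTo τ (Icc 0 b) (Icc 0 a) ∧
      RightInvOn τ f (Icc 0 b) := by
  have hmaps := h.surjOn.mapsTo_invFunOn
  have hinv := h.surjOn.rightInvOn_invFunOn
  refine ⟨_, fun v hv w hw hvw => ?_, hmaps, hinv⟩
  rcases hvw.eq_or_lt with rfl | hlt
  · exact le_rfl
  · by_contra! hle
    have := h.1 (hmaps hw) (hmaps hv) hle.le
    rw [hinv hv, hinv hw] at this
    exact this.not_gt hlt

variable {d : ℕ} {P Q S T : Curve d} {z : Pt d} {ρ : ℕ → ℕ} {X : ℝ → ℝ}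
  {a c δ κ μ r x y D : ℝ}

lemma Matched.exists_monotoneOn (h : Matched P T a y D) :
    ∃ X : ℝ → ℝ, MonotoneOn X (Icc 0 y) ∧
      ∀ v ∈ Icc 0 y, 0 ≤ X v ∧ dist (P.eval (X v)) (T.eval v) ≤ D := by
  obtain ⟨f, g, hf, hg, h⟩ := h
  obtain ⟨τ, hτ, hmaps, hinv⟩ := hg.exists_monotoneOn_rightInvOn
  refine ⟨f ∘ τ, hf.1.comp hτ hmaps, fun v hv => ⟨(hf.mapsTo (hmaps hv)).1, ?_⟩⟩
  simpa only [Function.comp_apply, hinv hv] using h (τ v) (hmaps hv)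

lemma IsSimplification.exists_matched (h : IsSimplification μ P S ρ) (hm : Matched S T x y δ) :
    ∃ a, Matched P T a y (μ + δ) := by
  have hx : min x (S.size - 1) ∈ Icc (0 : ℝ) (S.size - 1) :=
    ⟨le_min hm.nonneg_left S.size_sub_one_nonneg, min_le_right _ _⟩
  obtain ⟨μ', hμ', hnear⟩ := h.exists_near_le
  obtain ⟨a, ha, hax⟩ := h.monoOnto_interp.surjOn hx
  have hσ := h.monoOnto_interp.restrict ha
  rw [hax] at hσ
  exact ⟨a, hm.clip_left.pullback hσ fun u hu =>
    (h.dist_eval_interp_le hnear hu.1).trans hμ'.le⟩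

lemma Curve.abs_clipped_dist_eval_sub_le_of_mem_Icc (P : Curve d) (z : Pt d) (R : ℝ) {p q u v : ℝ}
    (hp : 0 ≤ p) (hu : u ∈ Icc p q) (hv : v ∈ Icc p q) :
    |min (dist (P.eval v) z) R - min (dist (P.eval u) z) R| ≤
      P.lengthTo z R q - P.lengthTo z R p := by
  wlog huv : u ≤ v generalizing u v
  · rw [abs_sub_comm]
    exact this hv hu (le_of_not_ge huv)
  · exact (P.abs_clipped_dist_eval_sub_le z R (hp.trans hu.1) huv).trans
      (sub_le_sub (P.monotone_lengthTo z R hv.2) (P.monotone_lengthTo z R hu.1))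

/- One of the ends of a long edge of `T` is far from the point of the edge that is near `z`. So
between the points of `P` matched with the two, `P` crosses the annulus `3δ ≤ |· - z| ≤ 5δ`. -/
lemma Curve.two_mul_le_lengthTo_sub (hX : MonotoneOn X (Icc x (x + 1)))
    (hdist : ∀ v ∈ Icc x (x + 1), 0 ≤ X v ∧ dist (P.eval (X v)) (T.eval v) ≤ 2 * δ)
    (hlong : 16 * δ < dist (T.eval x) (T.eval (x + 1))) (hy : y ∈ Icc x (x + 1))
    (hz : dist z (T.eval y) ≤ δ) :
    2 * δ ≤ P.lengthTo z (5 * δ) (X (x + 1)) - P.lengthTo z (5 * δ) (X x) := by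
  have hleft : x ∈ Icc x (x + 1) := left_mem_Icc.mpr (by linarith)
  have hright : x + 1 ∈ Icc x (x + 1) := right_mem_Icc.mpr (by linarith)
  obtain ⟨v, hv, hfar⟩ : ∃ v ∈ Icc x (x + 1), 8 * δ ≤ dist (T.eval v) (T.eval y) := by
    by_contra! hnear
    linarith [hnear x hleft, hnear (x + 1) hright,
      dist_triangle_right (T.eval x) (T.eval (x + 1)) (T.eval y)]
  have houter : 5 * δ ≤ dist (P.eval (X v)) z := by
    linarith [dist_triangle4_left (P.eval (X v)) z (T.eval v) (T.eval y), (hdist v hv).2]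
  have hinner : dist (P.eval (X y)) z ≤ 3 * δ := by
    linarith [dist_triangle_right (P.eval (X y)) z (T.eval y), (hdist y hy).2]
  have hbetween : ∀ u ∈ Icc x (x + 1), X u ∈ Icc (X x) (X (x + 1)) := fun u hu =>
    ⟨hX hleft hu hu.1, hX hu hright hu.2⟩
  have hcross := P.abs_clipped_dist_eval_sub_le_of_mem_Icc z (5 * δ) (hdist x hleft).1
    (hbetween y hy) (hbetween v hv)
  rw [min_eq_right houter] at hcross
  linarith [le_abs_self (5 * δ - min (dist (P.eval (X y)) z) (5 * δ)),
    min_le_left (dist (P.eval (X y)) z) (5 * δ)]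

lemma Curve.IsPacked.card_long_le (hP : P.IsPacked c) (hδ : 0 < δ) {J : ℕ}
    (hX : MonotoneOn X (Icc 0 J))
    (hdist : ∀ v ∈ Icc (0 : ℝ) J, 0 ≤ X v ∧ dist (P.eval (X v)) (T.eval v) ≤ 2 * δ)
    {B : Finset ℕ} (hB : ∀ j ∈ B, j < J ∧ 16 * δ < dist (T.vertex j) (T.vertex (j + 1)) ∧
      ∃ y ∈ Icc (j : ℝ) (j + 1), dist z (T.eval y) ≤ δ) :
    (B.card : ℝ) ≤ 5 / 2 * c := by
  have hmem : ∀ j : ℕ, j ≤ J → (j : ℝ) ∈ Icc (0 : ℝ) J := fun j hj =>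
    ⟨j.cast_nonneg, Nat.cast_le.mpr hj⟩
  have hsub : ∀ j < J, Icc (j : ℝ) (j + 1) ⊆ Icc (0 : ℝ) J := fun j hj =>
    Icc_subset_Icc j.cast_nonneg (by exact_mod_cast hj)
  have hsum : B.card * (2 * δ) ≤
      P.lengthTo z (5 * δ) (X J) - P.lengthTo z (5 * δ) (X (0 : ℕ)) := by
    refine card_mul_le_of_increments (H := fun j => P.lengthTo z (5 * δ) (X j))
      (fun j hj => P.monotone_lengthTo z _ (hX (hmem j hj.le) (hmem (j + 1) hj)
        (Nat.cast_le.mpr j.le_succ))) fun j hj => ?_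
    obtain ⟨hjJ, hlong, y, hy, hz⟩ := hB j hj
    rw [← T.eval_natCast j, ← T.eval_natCast (j + 1), Nat.cast_add_one] at hlong
    rw [Nat.cast_add_one]
    exact ⟨hjJ, Curve.two_mul_le_lengthTo_sub (hX.mono (hsub j hjJ))
      (fun v hv => hdist v (hsub j hjJ hv)) hlong hy hz⟩
  have hball := (P.lengthTo_le_lengthInBall z (5 * δ) (X J)).trans (hP z (5 * δ) (by positivity))
  refine le_of_mul_le_mul_right ?_ hδ
  linarith [P.lengthTo_nonneg z (5 * δ) (X (0 : ℕ))]

namespace IsSimplification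

lemma card_long_le (h : IsSimplification μ P S ρ) (hP : P.IsPacked c) (hc : 0 ≤ c) (hμδ : μ ≤ δ)
    {i : ℕ} {B : Finset ℕ} (hB : ∀ j ∈ B, 16 * δ < dist (T.vertex j) (T.vertex (j + 1)) ∧
      ∃ y ∈ Icc (j : ℝ) (j + 1), Matched S T i y δ) :
    (B.card : ℝ) ≤ 5 / 2 * c + 1 := by
  rcases B.eq_empty_or_nonempty with rfl | hne
  · rw [Finset.card_empty, Nat.cast_zero]
    positivity
  have hJ := B.max'_mem hne
  obtain ⟨-, y, hy, hm⟩ := hB _ hJ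
  obtain ⟨a, hm⟩ := h.exists_matched hm
  obtain ⟨X, hX, hdist⟩ := hm.exists_monotoneOn
  have hsub : Icc (0 : ℝ) (B.max' hne) ⊆ Icc 0 y := Icc_subset_Icc_right hy.1
  have hcard := hP.card_long_le (B := B.erase (B.max' hne)) (z := S.vertex i)
    (h.scale_pos.trans_le hμδ) (hX.mono hsub)
    (fun v hv => ⟨(hdist v (hsub hv)).1, (hdist v (hsub hv)).2.trans (by linarith)⟩)
    fun j hj => by
      obtain ⟨hjJ, hjB⟩ := Finset.mem_erase.mp hj
      obtain ⟨hlong, v, hv, hmv⟩ := hB j hjB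
      have hfree := hmv.dist_le
      rw [S.eval_natCast] at hfree
      exact ⟨(B.le_max' j hjB).lt_of_ne hjJ, hlong, v, hv, hfree⟩
  rw [← Finset.card_erase_add_one hJ, Nat.cast_add_one]
  linarith

lemma card_near_le (h : IsSimplification μ P S ρ) (hP : P.IsPacked c) (hr : 0 ≤ r)
    {A : Finset ℕ} (hA : ∀ k ∈ A, k < S.edges)
    (hz : ∀ k ∈ A, ∃ x ∈ Icc (k : ℝ) (k + 1), dist (S.eval x) z ≤ r) :
    (A.card : ℝ) ≤ c * (r / μ + 4) + 1 := by
  have hμ := h.scale_pos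
  have hedges := h.card_edges_mul_le hP hr (A := A.filter fun k => k + 1 < S.size)
    (fun k hk => (Finset.mem_filter.mp hk).2) fun k hk => hz k (Finset.mem_filter.mp hk).1
  have hsub : A ⊆ insert 0 (A.filter fun k => k + 1 < S.size) := fun k hk => by
    have hk_lt := hA k hk
    rw [Finset.mem_insert, Finset.mem_filter]
    rw [Curve.edges] at hk_lt
    rcases Nat.eq_zero_or_pos k with h0 | h0
    · exact .inl h0
    · exact .inr ⟨hk, by omega⟩
  have hcard : (A.card : ℝ) ≤ (A.filter fun k => k + 1 < S.size).card + 1 := by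
    exact_mod_cast (Finset.card_le_card hsub).trans (Finset.card_insert_le _ _)
  rw [← le_div_iff₀ hμ] at hedges
  have : c * (r + 4 * μ) / μ = c * (r / μ + 4) := by field_simp
  linarith

end IsSimplification

lemma ReachableCell.near_or_long {p : ℕ × ℕ} (h : ReachableCell S T δ p) (hδ : 0 ≤ δ) :
    (∃ x ∈ Icc (p.1 : ℝ) (p.1 + 1), dist (S.eval x) (T.vertex p.2) ≤ 17 * δ) ∨
      (16 * δ < dist (T.vertex p.2) (T.vertex (p.2 + 1)) ∧
        ∃ y ∈ Icc (p.2 : ℝ) (p.2 + 1), Matched S T p.1 y δ) := by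
  obtain ⟨-, -, ⟨x, y⟩, ⟨hx, hy⟩, hside | hside, hm⟩ := h <;> dsimp only at hx hy hside hm <;>
    subst hside
  · refine or_iff_not_imp_right.mpr fun hshort => ⟨p.1, hx, ?_⟩
    have hshort : dist (T.vertex p.2) (T.vertex (p.2 + 1)) ≤ 16 * δ :=
      not_lt.mp fun hlt => hshort ⟨hlt, y, hy, hm⟩
    have hyT : dist (T.eval y) (T.vertex p.2) ≤ 16 * δ := by
      have ht := sub_mem_unitInterval hy
      rw [T.eval_eq_lineMap hy, dist_lineMap_left, Real.norm_of_nonneg ht.1]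
      exact (mul_le_of_le_one_left dist_nonneg ht.2).trans hshort
    linarith [dist_triangle (S.eval p.1) (T.eval y) (T.vertex p.2), hm.dist_le]
  · refine .inl ⟨x, hx, ?_⟩
    have := hm.dist_le
    rw [T.eval_natCast] at this
    linarith

/- A cell is counted in its row if the edge of `S` comes near the vertex `p.2` of `T`, and in its
column otherwise. -/
lemma IsSimplification.card_reachableCells_le (h : IsSimplification μ P S ρ) (hP : P.IsPacked c)
    (hc : 1 ≤ c) (hμδ : μ ≤ δ) (hκ : δ ≤ κ * μ) {A : Finset (ℕ × ℕ)}
    (hA : ∀ p ∈ A, ReachableCell S T δ p) :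
    (A.card : ℝ) ≤ 22 * κ * c * (S.edges + T.edges) := by
  classical
  let Near (p : ℕ × ℕ) : Prop :=
    ∃ x ∈ Icc (p.1 : ℝ) (p.1 + 1), dist (S.eval x) (T.vertex p.2) ≤ 17 * δ
  have hμ := h.scale_pos
  have hδ : 0 < δ := hμ.trans_le hμδ
  have hκ1 : 1 ≤ κ := le_of_mul_le_mul_right (by linarith) hμ
  have hnear : ((A.filter Near).card : ℝ) ≤ T.edges * (c * (17 * δ / μ + 4) + 1) :=
    card_le_mul_of_card_rows_le (fun p hp => (hA p (Finset.mem_filter.mp hp).1).2.1) fun j B hB =>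
      h.card_near_le hP (z := T.vertex j) (by positivity)
        (fun k hk => (hA _ (Finset.mem_filter.mp (hB k hk)).1).1)
        fun k hk => (Finset.mem_filter.mp (hB k hk)).2
  have hlong : ((A.filter fun p => ¬ Near p).card : ℝ) ≤ S.edges * (5 / 2 * c + 1) :=
    card_le_mul_of_card_columns_le (fun p hp => (hA p (Finset.mem_filter.mp hp).1).1)
      fun i B hB => h.card_long_le hP (by positivity) hμδ fun j hj =>
        have ⟨hjA, hfar⟩ := Finset.mem_filter.mp (hB j hj)
        ((hA _ hjA).near_or_long hδ.le).resolve_left hfar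
  have hratio : 17 * δ / μ ≤ 17 * κ := by
    rw [div_le_iff₀ hμ]
    linarith
  have hcκ : c ≤ c * κ := le_mul_of_one_le_right (by positivity) hκ1
  have hrow : c * (17 * δ / μ + 4) + 1 ≤ 22 * κ * c := by
    have : c * (17 * δ / μ) ≤ c * (17 * κ) := by gcongr
    linarith
  rw [← Finset.card_filter_add_card_filter_not Near, Nat.cast_add, mul_add, add_comm]
  refine add_le_add (hlong.trans ?_) (hnear.trans ?_) <;> rw [mul_comm (22 * κ * c)] <;>
    refine mul_le_mul_of_nonneg_left ?_ (Nat.cast_nonneg _) <;> linarith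

theorem card_reachableCells_le {ρ' : ℕ → ℕ} (hS : IsSimplification μ P S ρ)
    (hT : IsSimplification μ Q T ρ') (hPQ : P.IsPacked c ∨ Q.IsPacked c) (hc : 1 ≤ c)
    (hμδ : μ ≤ δ) (hκ : δ ≤ κ * μ) {A : Finset (ℕ × ℕ)}
    (hA : ∀ p ∈ A, ReachableCell S T δ p) :
    (A.card : ℝ) ≤ 22 * κ * c * (S.edges + T.edges) := by
  rcases hPQ with hP | hQ
  · exact hS.card_reachableCells_le hP hc hμδ hκ hA
  · rw [← Finset.card_map (Equiv.prodComm ℕ ℕ).toEmbedding, add_comm]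
    refine hT.card_reachableCells_le hQ hc hμδ hκ fun p hp => ?_
    obtain ⟨q, hq, rfl⟩ := Finset.mem_map.mp hp
    exact (hA q hq).swap

end Counting

/-! ### The fallible decider -/

section FallibleDecider

variable {d : ℕ} {P Q S T : Curve d} {ρ ρ' : ℕ → ℕ} {c D N Δ ε μ : ℝ}

lemma frechetDist_le_of_matched_simplifications (hS : IsSimplification μ P S ρ)
    (hT : IsSimplification μ Q T ρ') (h : Matched S T (S.size - 1) (T.size - 1) D) :
    frechetDist P Q ≤ 2 * μ + D := by
  have hP := h.pullback hS.monoOnto_interp fun u hu =>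
    hS.dist_eval_interp_le (fun l => (hS.near l).le) hu.1
  have hQ := hP.symm.pullback hT.monoOnto_interp fun u hu =>
    hT.dist_eval_interp_le (fun l => (hT.near l).le) hu.1
  exact (frechetDist_le_of_matched hQ.symm).trans (by linarith)

/- The infimum in `frechetDist` need not be known to be attained, because a simplification stays at
distance less than `μ`. -/
lemma matched_simplifications_of_frechetDist_le (hS : IsSimplification μ P S ρ)
    (hT : IsSimplification μ Q T ρ') (h : frechetDist P Q ≤ D) :
    Matched S T (S.size - 1) (T.size - 1) (2 * μ + D) := by
  obtain ⟨μ₁, hμ₁, hS_near⟩ := hS.exists_near_le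
  obtain ⟨μ₂, hμ₂, hT_near⟩ := hT.exists_near_le
  have hPQ : Matched P Q (P.size - 1) (Q.size - 1) (2 * μ + D - μ₁ - μ₂) :=
    matched_of_frechetDist_lt (by linarith)
  have hSQ := hPQ.pushforward hS.monoOnto_interp fun u hu => hS.dist_eval_interp_le hS_near hu.1
  have hTS := hSQ.symm.pushforward hT.monoOnto_interp fun u hu =>
    hT.dist_eval_interp_le hT_near hu.1
  convert hTS.symm using 1
  ring

/-- The bound `K` on the number of cells that the fallible decider explores, for two curves with `N`
vertices in total. -/
noncomputable def cellBudget (ε c N : ℝ) : ℝ :=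
  (1 + ε) * (1 + ε) * (27 * c + 96 * c / ε) * N

lemma mul_le_cellBudget (hε : 0 < ε) (hc : 0 ≤ c) (hN : 0 ≤ N) :
    22 * (4 / ε + 2) * c * N ≤ cellBudget ε c N := by
  refine mul_le_mul_of_nonneg_right ?_ hN
  have hexpand : (1 + ε) * (1 + ε) * (27 * c + 96 * c / ε) =
      22 * (4 / ε + 2) * c + (8 / ε + 175 + 150 * ε + 27 * ε ^ 2) * c := by
    field_simp
    ring
  rw [hexpand]
  exact le_add_of_nonneg_right (by positivity)

lemma cellBudget_le (hε : 0 < ε) (hε1 : ε ≤ 1) (hc : 0 ≤ c) (hN : 0 ≤ N) :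
    cellBudget ε c N ≤ 492 * (c * (N / ε)) := by
  have hquot : c ≤ c / ε := le_div_self hc hε hε1
  have hsum : 27 * c + 96 * c / ε ≤ 123 * (c / ε) := by
    rw [mul_div_assoc]
    linarith
  have hsq : (1 + ε) * (1 + ε) ≤ 4 := by nlinarith
  calc cellBudget ε c N ≤ 4 * (123 * (c / ε)) * N :=
        mul_le_mul_of_nonneg_right (mul_le_mul hsq hsum (by positivity) (by norm_num)) hN
    _ = 492 * (c * (N / ε)) := by ring

lemma exists_fallibleDecider_val_eq (P Q : Curve d) (c : ℝ) (hΔ : 0 < Δ) (hε : 0 < ε) :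
    ∃ S T ρ ρ', IsSimplification (ε / 4 * Δ) P S ρ ∧ IsSimplification (ε / 4 * Δ) Q T ρ' ∧
      (fallibleDecider P Q Δ ε c).val = (explore S T ((1 + ε / 2) * Δ)
        (⌊cellBudget ε c (P.size + Q.size : ℕ)⌋₊ + 1)
        (startQueue S T ((1 + ε / 2) * Δ)).val).val := by
  have hμ : 0 < ε / 4 * Δ := by positivity
  obtain ⟨ρ, hS⟩ := exists_isSimplification hμ P
  obtain ⟨ρ', hT⟩ := exists_isSimplification hμ Q
  refine ⟨_, _, ρ, ρ', hS, hT, ?_⟩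
  simp only [fallibleDecider, cellBudget, Timed.bind_val, op_val, countBeyond]

theorem frechetDist_le_of_fallibleDecider_yes (hΔ : 0 < Δ) (hε : 0 < ε)
    (h : (fallibleDecider P Q Δ ε c).val = Answer.yes) : frechetDist P Q ≤ (1 + ε) * Δ := by
  obtain ⟨S, T, ρ, ρ', hS, hT, hval⟩ := exists_fallibleDecider_val_eq P Q c hΔ hε
  rw [hval] at h
  refine (frechetDist_le_of_matched_simplifications hS hT (matched_of_explore_yes (by positivity)
    queueOrdered_startQueue isSound_startQueue h)).trans_eq ?_
  ring

theorem lt_frechetDist_of_fallibleDecider_no (hΔ : 0 < Δ) (hε : 0 < ε)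
    (h : (fallibleDecider P Q Δ ε c).val = Answer.no) : Δ < frechetDist P Q := by
  obtain ⟨S, T, ρ, ρ', hS, hT, hval⟩ := exists_fallibleDecider_val_eq P Q c hΔ hε
  rw [hval] at h
  by_contra! hle
  have hm := matched_simplifications_of_frechetDist_le hS hT hle
  rw [show 2 * (ε / 4 * Δ) + Δ = (1 + ε / 2) * Δ by ring] at hm
  exact explore_startQueue_ne_no (by positivity) hm h

theorem fallibleDecider_ne_timeout (hΔ : 0 < Δ) (hε : 0 < ε) (hc : 1 ≤ c)
    (hPQ : P.IsPacked c ∨ Q.IsPacked c) : (fallibleDecider P Q Δ ε c).val ≠ Answer.timeout := by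
  obtain ⟨S, T, ρ, ρ', hS, hT, hval⟩ := exists_fallibleDecider_val_eq P Q c hΔ hε
  rw [hval]
  intro h
  obtain ⟨A, hcard, hA⟩ := exists_reachableCells_of_explore_timeout (by positivity)
    queueOrdered_startQueue isSound_startQueue h
  have hμδ : ε / 4 * Δ ≤ (1 + ε / 2) * Δ := mul_le_mul_of_nonneg_right (by linarith) hΔ.le
  have hκ : (1 + ε / 2) * Δ = (4 / ε + 2) * (ε / 4 * Δ) := by
    field_simp
    ring
  have hedges : (S.edges : ℝ) + T.edges ≤ (P.size + Q.size : ℕ) := by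
    exact_mod_cast Nat.add_le_add (S.edges_le_size.trans hS.size_le)
      (T.edges_le_size.trans hT.size_le)
  have hle : (A.card : ℝ) ≤ cellBudget ε c (P.size + Q.size : ℕ) := calc
    (A.card : ℝ) ≤ 22 * (4 / ε + 2) * c * (S.edges + T.edges) :=
      card_reachableCells_le hS hT hPQ hc hμδ hκ.le fun p hp => (hA p hp).1
    _ ≤ 22 * (4 / ε + 2) * c * (P.size + Q.size : ℕ) :=
      mul_le_mul_of_nonneg_left hedges (by positivity)
    _ ≤ _ := mul_le_cellBudget hε (by positivity) (Nat.cast_nonneg _)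
  rw [hcard, Nat.cast_add_one] at hle
  exact (Nat.lt_floor_add_one _).not_ge hle

/-- The number of vertices divided by `ε`: the unit in which running times are measured. -/
noncomputable def workUnit (P Q : Curve d) (ε : ℝ) : ℝ := (P.size + Q.size) / ε

lemma two_le_size_add_size (P Q : Curve d) : (2 : ℝ) ≤ P.size + Q.size := by
  exact_mod_cast Nat.add_le_add P.size_pos Q.size_pos

lemma workUnit_pos (P Q : Curve d) (hε : 0 < ε) : 0 < workUnit P Q ε :=
  div_pos (two_pos.trans_le (two_le_size_add_size P Q)) hε

lemma fallibleDecider_steps_le_floor (P Q : Curve d) (Δ ε c : ℝ) :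
    (fallibleDecider P Q Δ ε c).steps ≤
      4 * (P.size + Q.size) + 92 + 71 * ⌊cellBudget ε c (P.size + Q.size : ℕ)⌋₊ := by
  simp only [fallibleDecider, cellBudget, Timed.bind_steps, op_steps, op_val, startQueue_steps,
    countBeyond]
  have hP := simplify_steps_le (ε / 4 * Δ) P
  have hQ := simplify_steps_le (ε / 4 * Δ) Q
  generalize ⌊(1 + ε) * (1 + ε) * (27 * c + 96 * c / ε) * ((P.size + Q.size : ℕ) : ℝ)⌋₊ = K
  have hexplore := explore_steps_le (simplify (ε / 4 * Δ) P).val (simplify (ε / 4 * Δ) Q).val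
    ((1 + ε / 2) * Δ) (K + 1)
    (startQueue (simplify (ε / 4 * Δ) P).val (simplify (ε / 4 * Δ) Q).val ((1 + ε / 2) * Δ)).val
  generalize (explore _ _ _ _ _).steps = e at hexplore ⊢
  generalize (simplify (ε / 4 * Δ) P).steps = a at hP ⊢
  generalize (simplify (ε / 4 * Δ) Q).steps = b at hQ ⊢
  linarith

lemma fallibleDecider_steps_add_four_le (P Q : Curve d) (Δ : ℝ) (hε : 0 < ε) (hε1 : ε ≤ 1)
    (hc : 1 ≤ c) :
    (fallibleDecider P Q Δ ε c).steps + 4 ≤ 35000 * (c * workUnit P Q ε) := by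
  have hN := two_le_size_add_size P Q
  have hsize : (P.size : ℝ) + Q.size ≤ c * workUnit P Q ε :=
    (le_div_self (by positivity) hε hε1).trans
      (le_mul_of_one_le_left (workUnit_pos P Q hε).le hc)
  have hsteps : ((fallibleDecider P Q Δ ε c).steps : ℝ) ≤
      4 * (P.size + Q.size) + 92 + 71 * ⌊cellBudget ε c (P.size + Q.size : ℕ)⌋₊ := by
    exact_mod_cast fallibleDecider_steps_le_floor P Q Δ ε c
  have hbudget : cellBudget ε c (P.size + Q.size : ℕ) ≤ 492 * (c * workUnit P Q ε) := by
    rw [workUnit, ← Nat.cast_add]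
    exact cellBudget_le hε hε1 (by positivity) (Nat.cast_nonneg _)
  have hbudget_nonneg : 0 ≤ cellBudget ε c (P.size + Q.size : ℕ) := by
    unfold cellBudget
    positivity
  have hfloor := (Nat.floor_le hbudget_nonneg).trans hbudget
  linarith

end FallibleDecider

/-! ### The search for the threshold -/

section Search

open Filter

attribute [ext] Timed

variable {d : ℕ} {P Q : Curve d} {D Δ Δup ε c r ρ : ℝ} {b k : ℕ}

/-- The list `r ^ 2 ^ (k - 1), …, r ^ 2 ^ 0` of the probe factors of a binary search in an interval
of length `2 ^ k`, in the order in which `binarySearch` uses them. -/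
def powList (r : ℝ) : ℕ → List ℝ
  | 0 => []
  | k + 1 => r ^ 2 ^ k :: powList r k

lemma scan_succ_of_yes {pows : List ℝ}
    (h : (fallibleDecider P Q (Δup / r) ε c).val = Answer.yes) :
    scan P Q Δup ε c (k + 1) r pows = ⟨(scan P Q Δup ε c k (r * r) (r :: pows)).val,
      (fallibleDecider P Q (Δup / r) ε c).steps + 4 +
        (scan P Q Δup ε c k (r * r) (r :: pows)).steps⟩ := by
  ext
  · simp [scan, h]
  · simp [scan, h]
    ring

lemma scan_succ_of_ne_yes {pows : List ℝ}
    (h : (fallibleDecider P Q (Δup / r) ε c).val ≠ Answer.yes) :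
    scan P Q Δup ε c (k + 1) r pows =
      ⟨some pows, (fallibleDecider P Q (Δup / r) ε c).steps + 3⟩ := by
  ext
  · simp [scan]
  · simp [scan]
    ring

lemma exists_scan_eq (hD : ∀ Δ, ((fallibleDecider P Q Δ ε c).steps : ℝ) + 4 ≤ D)
    (hyes : ∀ i < b, (fallibleDecider P Q (Δup / r ^ 2 ^ i) ε c).val = Answer.yes)
    (hb : (fallibleDecider P Q (Δup / r ^ 2 ^ b) ε c).val ≠ Answer.yes) (m i : ℕ)
    (hi : i + m = b) :
    ∃ steps : ℕ, (steps : ℝ) ≤ (m + 1) * D ∧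
      ∀ k, scan P Q Δup ε c (k + (m + 1)) (r ^ 2 ^ i) (powList r i) =
        ⟨some (powList r b), steps⟩ := by
  have hDi := hD (Δup / r ^ 2 ^ i)
  induction m generalizing i with
  | zero =>
    obtain rfl : i = b := hi
    refine ⟨_, ?_, fun k => scan_succ_of_ne_yes hb⟩
    push_cast
    linarith
  | succ m ih =>
    obtain ⟨steps, hsteps, hscan⟩ := ih (i + 1) (by omega) (hD _)
    have hsq : r ^ 2 ^ i * r ^ 2 ^ i = r ^ 2 ^ (i + 1) := by rw [← pow_add, ← two_mul, pow_succ']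
    refine ⟨(fallibleDecider P Q (Δup / r ^ 2 ^ i) ε c).steps + 4 + steps, ?_, fun k => ?_⟩
    · push_cast
      linarith
    · rw [← add_assoc, scan_succ_of_yes (hyes i (by omega)), hsq, ← powList, hscan k]

lemma binarySearch_cons_of_yes {rs : List ℝ}
    (h : (fallibleDecider P Q (Δ / r) ε c).val = Answer.yes) :
    binarySearch P Q ε c Δ (r :: rs) = ⟨(binarySearch P Q ε c (Δ / r) rs).val,
      (fallibleDecider P Q (Δ / r) ε c).steps + 2 +
        (binarySearch P Q ε c (Δ / r) rs).steps⟩ := by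
  ext
  · simp [binarySearch, h]
  · simp [binarySearch, h]
    ring

lemma binarySearch_cons_of_ne_yes {rs : List ℝ}
    (h : (fallibleDecider P Q (Δ / r) ε c).val ≠ Answer.yes) :
    binarySearch P Q ε c Δ (r :: rs) = ⟨(binarySearch P Q ε c Δ rs).val,
      (fallibleDecider P Q (Δ / r) ε c).steps + 2 + (binarySearch P Q ε c Δ rs).steps⟩ := by
  ext
  · simp [binarySearch]
  · simp [binarySearch]
    ring

/-- The fallible decider reports "yes" at `Δ`, but not at the next value `Δ / (1 + ε)` of the
geometric sequence that is searched. -/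
structure IsThreshold (P Q : Curve d) (ε c Δ : ℝ) : Prop where
  pos : 0 < Δ
  yes : (fallibleDecider P Q Δ ε c).val = Answer.yes
  ne_yes : (fallibleDecider P Q (Δ / (1 + ε)) ε c).val ≠ Answer.yes

lemma binarySearch_spec (hε : 0 < ε)
    (hD : ∀ Δ, ((fallibleDecider P Q Δ ε c).steps : ℝ) + 4 ≤ D) (hΔ : 0 < Δ)
    (hyes : (fallibleDecider P Q Δ ε c).val = Answer.yes)
    (hne : (fallibleDecider P Q (Δ / (1 + ε) ^ 2 ^ b) ε c).val ≠ Answer.yes) :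
    IsThreshold P Q ε c (binarySearch P Q ε c Δ (powList (1 + ε) b)).val ∧
      ((binarySearch P Q ε c Δ (powList (1 + ε) b)).steps : ℝ) ≤ b * D + 1 := by
  induction b generalizing Δ with
  | zero =>
    simp only [powList, binarySearch, op_val, op_steps]
    exact ⟨⟨hΔ, hyes, by simpa using hne⟩, by simp⟩
  | succ b ih =>
    have hmid := hD (Δ / (1 + ε) ^ 2 ^ b)
    rw [powList]
    by_cases hyes_mid : (fallibleDecider P Q (Δ / (1 + ε) ^ 2 ^ b) ε c).val = Answer.yes
    · have hsq : Δ / (1 + ε) ^ 2 ^ b / (1 + ε) ^ 2 ^ b = Δ / (1 + ε) ^ 2 ^ (b + 1) := by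
        rw [div_div, ← pow_add, ← two_mul, pow_succ']
      obtain ⟨hthreshold, hsteps⟩ := ih (by positivity) hyes_mid (by rwa [hsq])
      rw [binarySearch_cons_of_yes hyes_mid]
      refine ⟨hthreshold, ?_⟩
      push_cast
      linarith
    · obtain ⟨hthreshold, hsteps⟩ := ih hΔ hyes hyes_mid
      rw [binarySearch_cons_of_ne_yes hyes_mid]
      refine ⟨hthreshold, ?_⟩
      push_cast
      linarith

lemma half_le_log_one_add (hε : 0 ≤ ε) (hε2 : ε ≤ 2) : ε / 2 ≤ Real.log (1 + ε) :=
  (Real.le_log_one_add_of_nonneg hε).trans' <| by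
    rw [div_le_div_iff₀ two_pos (by positivity)]
    nlinarith

lemma two_pow_le_of_one_add_pow_le (hε : 0 < ε) (hε2 : ε ≤ 2) (hρ : 0 < ρ)
    (h : (1 + ε) ^ 2 ^ b ≤ (1 + ε) * ρ) : (2 : ℝ) ^ b ≤ 2 * (1 + 1 / ε * Real.log ρ) := by
  have hlog : (2 : ℝ) ^ b * Real.log (1 + ε) ≤ Real.log (1 + ε) + Real.log ρ := by
    have := Real.log_le_log (by positivity) h
    rwa [Real.log_pow, Real.log_mul (by positivity) hρ.ne', Nat.cast_pow, Nat.cast_two] at this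
  have hpow : (1 : ℝ) ≤ 2 ^ b := one_le_pow₀ one_le_two
  have hmul : ((2 : ℝ) ^ b - 1) * (ε / 2) ≤ Real.log ρ := calc
    ((2 : ℝ) ^ b - 1) * (ε / 2) ≤ (2 ^ b - 1) * Real.log (1 + ε) :=
      mul_le_mul_of_nonneg_left (half_le_log_one_add hε.le hε2) (by linarith)
    _ ≤ Real.log ρ := by linarith
  have hdiv := (le_div_iff₀ (by positivity)).mpr hmul
  rw [show Real.log ρ / (ε / 2) = 2 * (1 / ε * Real.log ρ) by field_simp] at hdiv
  linarith

lemma add_one_le_of_two_pow_le {x : ℝ} (hx : 1 ≤ x) (h : (2 : ℝ) ^ b ≤ 2 * x) :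
    (b : ℝ) + 1 ≤ 2 * (1 + Real.log x) := by
  have hlog : b * Real.log 2 ≤ Real.log 2 + Real.log x := by
    have := Real.log_le_log (by positivity) h
    rwa [Real.log_pow, Real.log_mul two_ne_zero (by positivity)] at this
  have hx_log : 0 ≤ Real.log x := Real.log_nonneg hx
  have htwo := Real.log_two_gt_d9
  by_contra! hlt
  nlinarith

/-- The logarithmic factor of the running time. -/
noncomputable def logFactor (P Q : Curve d) (Δup ε : ℝ) : ℝ :=
  1 + Real.log (1 + 1 / ε * Real.log (Δup / frechetDist P Q))

lemma one_le_one_add_log_ratio (hpos : 0 < frechetDist P Q) (hup : frechetDist P Q ≤ Δup)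
    (hε : 0 < ε) : 1 ≤ 1 + 1 / ε * Real.log (Δup / frechetDist P Q) :=
  le_add_of_nonneg_right <|
    mul_nonneg (by positivity) (Real.log_nonneg ((one_le_div hpos).mpr hup))

lemma one_le_logFactor (hpos : 0 < frechetDist P Q) (hup : frechetDist P Q ≤ Δup) (hε : 0 < ε) :
    1 ≤ logFactor P Q Δup ε :=
  le_add_of_nonneg_right (Real.log_nonneg (one_le_one_add_log_ratio hpos hup hε))

lemma le_two_mul_logFactor (hpos : 0 < frechetDist P Q) (hup : frechetDist P Q ≤ Δup)
    (hε : 0 < ε) (hε1 : ε ≤ 1)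
    (hyes : ∀ i < b, (fallibleDecider P Q (Δup / (1 + ε) ^ 2 ^ i) ε c).val = Answer.yes) :
    (b : ℝ) ≤ 2 * logFactor P Q Δup ε := by
  have hΔ : 0 < Δup := hpos.trans_le hup
  cases b with
  | zero =>
    have := one_le_logFactor hpos hup hε
    rw [Nat.cast_zero]
    positivity
  | succ b =>
    have hdist := frechetDist_le_of_fallibleDecider_yes (by positivity) hε (hyes b b.lt_succ_self)
    have hpow : (1 + ε) ^ 2 ^ b ≤ (1 + ε) * (Δup / frechetDist P Q) := by
      rw [← mul_div_assoc, le_div_iff₀ (by positivity)] at hdist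
      rwa [← mul_div_assoc, le_div_iff₀ hpos, mul_comm]
    rw [Nat.cast_succ]
    exact add_one_le_of_two_pow_le (one_le_one_add_log_ratio hpos hup hε)
      (two_pow_le_of_one_add_pow_le hε (by linarith) (by positivity) hpow)

lemma exists_first_ne_yes (P Q : Curve d) (c : ℝ) (hpos : 0 < frechetDist P Q)
    (hup : frechetDist P Q ≤ Δup) (hε : 0 < ε) (hε1 : ε ≤ 1) :
    ∃ b : ℕ, (∀ i < b, (fallibleDecider P Q (Δup / (1 + ε) ^ 2 ^ i) ε c).val = Answer.yes) ∧
      (fallibleDecider P Q (Δup / (1 + ε) ^ 2 ^ b) ε c).val ≠ Answer.yes := by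
  classical
  have hex : ∃ b, (fallibleDecider P Q (Δup / (1 + ε) ^ 2 ^ b) ε c).val ≠ Answer.yes := by
    by_contra! hall
    obtain ⟨n, hn⟩ := exists_nat_gt (2 * logFactor P Q Δup ε)
    exact hn.not_ge (le_two_mul_logFactor hpos hup hε hε1 fun i _ => hall i)
  exact ⟨Nat.find hex, fun i hi => not_not.mp (Nat.find_min hex hi), Nat.find_spec hex⟩

lemma exists_scan_eq_binarySearch_spec (hpos : 0 < frechetDist P Q)
    (hup : frechetDist P Q ≤ Δup) (hε : 0 < ε) (hε1 : ε ≤ 1)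
    (hD : ∀ Δ, ((fallibleDecider P Q Δ ε c).steps : ℝ) + 4 ≤ D)
    (hyes : (fallibleDecider P Q Δup ε c).val = Answer.yes) :
    ∃ (pows : List ℝ) (steps : ℕ),
      (∀ᶠ fuel in atTop, scan P Q Δup ε c fuel (1 + ε) [] = ⟨some pows, steps⟩) ∧
      IsThreshold P Q ε c (binarySearch P Q ε c Δup pows).val ∧
      (steps : ℝ) + (binarySearch P Q ε c Δup pows).steps ≤
        (4 * logFactor P Q Δup ε + 1) * D + 1 := by
  obtain ⟨b, hb_yes, hb⟩ := exists_first_ne_yes P Q c hpos hup hε hε1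
  obtain ⟨steps, hsteps, hscan⟩ := exists_scan_eq hD hb_yes hb b 0 b.zero_add
  obtain ⟨hthreshold, hsearch⟩ := binarySearch_spec hε hD (hpos.trans_le hup) hyes hb
  refine ⟨powList (1 + ε) b, steps, ?_, hthreshold, ?_⟩
  · filter_upwards [eventually_ge_atTop (b + 1)] with fuel hfuel
    obtain ⟨k, rfl⟩ := Nat.exists_eq_add_of_le' hfuel
    simpa [powList] using hscan k
  · have hD_nonneg : 0 ≤ D := (by positivity : (0 : ℝ) ≤ _ + 4).trans (hD 0)
    have hbD := mul_le_mul_of_nonneg_right (le_two_mul_logFactor hpos hup hε hε1 hb_yes) hD_nonneg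
    linarith

end Search

/-! ### Refining the upper bound -/

section Refine

open Filter

variable {d : ℕ} {P Q : Curve d} {D Δ Δup ε c c' : ℝ} {pows : List ℝ} {fuel k s t : ℕ}

/-- `Δ` approximates the Fréchet distance from above, within a factor `(1 + ε) ^ 2`. -/
def IsRefinedBound (P Q : Curve d) (ε Δ : ℝ) : Prop :=
  frechetDist P Q ≤ Δ ∧ Δ < (1 + ε) ^ 2 * frechetDist P Q

lemma Curve.IsPacked.mono (h : P.IsPacked c) (hcc' : c ≤ c') : P.IsPacked c' := fun x r hr =>
  (h x r hr).trans (mul_le_mul_of_nonneg_right hcc' hr.le)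

lemma fallibleDecider_eq_no (hΔ : 0 < Δ) (hε : 0 < ε) (hc : 1 ≤ c)
    (hPQ : P.IsPacked c ∨ Q.IsPacked c) (hne : (fallibleDecider P Q Δ ε c).val ≠ Answer.yes) :
    (fallibleDecider P Q Δ ε c).val = Answer.no := by
  have hne_timeout := fallibleDecider_ne_timeout hΔ hε hc hPQ
  cases h : (fallibleDecider P Q Δ ε c).val <;> simp_all

lemma IsThreshold.isRefinedBound (h : IsThreshold P Q ε c Δ) (hε : 0 < ε)
    (hno : (fallibleDecider P Q (Δ / (1 + ε)) ε c).val = Answer.no) :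
    IsRefinedBound P Q ε ((1 + ε) * Δ) := by
  have hΔ := h.pos
  have hlt := lt_frechetDist_of_fallibleDecider_no (by positivity) hε hno
  rw [div_lt_iff₀' (by positivity)] at hlt
  refine ⟨frechetDist_le_of_fallibleDecider_yes hΔ hε h.yes, ?_⟩
  rw [sq, mul_assoc]
  exact mul_lt_mul_of_pos_left hlt (by positivity)

lemma refineRound_of_ne_yes (fuel : ℕ)
    (h : (fallibleDecider P Q Δup ε c).val ≠ Answer.yes) :
    refineRound fuel P Q Δup ε c = ⟨some none, (fallibleDecider P Q Δup ε c).steps + 2⟩ := by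
  ext1 <;> simp [refineRound]

lemma refineRound_of_no (hyes : (fallibleDecider P Q Δup ε c).val = Answer.yes)
    (hscan : scan P Q Δup ε c fuel (1 + ε) [] = ⟨some pows, s⟩)
    (hno : (fallibleDecider P Q
      ((binarySearch P Q ε c Δup pows).val / (1 + ε)) ε c).val = Answer.no) :
    refineRound fuel P Q Δup ε c =
      ⟨some (some ((1 + ε) * (binarySearch P Q ε c Δup pows).val)),
        (fallibleDecider P Q Δup ε c).steps + (s + (binarySearch P Q ε c Δup pows).steps) +
          (fallibleDecider P Q
            ((binarySearch P Q ε c Δup pows).val / (1 + ε)) ε c).steps + 6⟩ := by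
  ext1
  · simp [refineRound, hyes, hscan, hno]
  · simp [refineRound, hyes, hscan, hno]
    ring

lemma refineRound_of_ne_no (hyes : (fallibleDecider P Q Δup ε c).val = Answer.yes)
    (hscan : scan P Q Δup ε c fuel (1 + ε) [] = ⟨some pows, s⟩)
    (hne : (fallibleDecider P Q
      ((binarySearch P Q ε c Δup pows).val / (1 + ε)) ε c).val ≠ Answer.no) :
    refineRound fuel P Q Δup ε c =
      ⟨some none,
        (fallibleDecider P Q Δup ε c).steps + (s + (binarySearch P Q ε c Δup pows).steps) +
          (fallibleDecider P Q
            ((binarySearch P Q ε c Δup pows).val / (1 + ε)) ε c).steps + 5⟩ := by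
  ext1
  · simp [refineRound, hyes, hscan]
  · simp [refineRound, hyes, hscan]
    ring

lemma exists_refineRound_eq (hpos : 0 < frechetDist P Q) (hup : frechetDist P Q ≤ Δup)
    (hε : 0 < ε) (hε1 : ε ≤ 1) (hc : 1 ≤ c)
    (hD : ∀ Δ, ((fallibleDecider P Q Δ ε c).steps : ℝ) + 4 ≤ D) :
    ∃ (res : Option ℝ) (steps : ℕ),
      (∀ᶠ fuel in atTop, refineRound fuel P Q Δup ε c = ⟨some res, steps⟩) ∧
      (steps : ℝ) + 1 ≤ 7 * logFactor P Q Δup ε * D ∧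
      (∀ Δ, res = some Δ → IsRefinedBound P Q ε Δ) ∧
      (P.IsPacked c ∨ Q.IsPacked c → res ≠ none) := by
  have hΔup : 0 < Δup := hpos.trans_le hup
  have hDup := hD Δup
  have hDL : D ≤ logFactor P Q Δup ε * D :=
    le_mul_of_one_le_left ((by positivity : (0 : ℝ) ≤ _ + 4).trans hDup)
      (one_le_logFactor hpos hup hε)
  by_cases hyes : (fallibleDecider P Q Δup ε c).val = Answer.yes
  swap
  · refine ⟨none, _, .of_forall fun fuel => refineRound_of_ne_yes fuel hyes, ?_, by simp, ?_⟩
    · push_cast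
      linarith
    · intro hPQ
      have hno := fallibleDecider_eq_no hΔup hε hc hPQ hyes
      exact absurd hup (lt_frechetDist_of_fallibleDecider_no hΔup hε hno).not_ge
  obtain ⟨pows, s, hscan, hthreshold, hsteps⟩ :=
    exists_scan_eq_binarySearch_spec hpos hup hε hε1 hD hyes
  have hDnext := hD ((binarySearch P Q ε c Δup pows).val / (1 + ε))
  by_cases hno : (fallibleDecider P Q
      ((binarySearch P Q ε c Δup pows).val / (1 + ε)) ε c).val = Answer.no
  · refine ⟨_, _, hscan.mono fun fuel h => refineRound_of_no hyes h hno, ?_, ?_, by simp⟩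
    · push_cast
      linarith
    · rintro _ ⟨⟩
      exact hthreshold.isRefinedBound hε hno
  · refine ⟨_, _, hscan.mono fun fuel h => refineRound_of_ne_no hyes h hno, ?_, by simp, ?_⟩
    · push_cast
      linarith
    · have hΔ := hthreshold.pos
      exact fun hPQ =>
        absurd (fallibleDecider_eq_no (by positivity) hε hc hPQ hthreshold.ne_yes) hno

lemma refineLoop_succ_of_some
    (h : refineRound fuel P Q Δup ε c = ⟨some (some Δ), s⟩) :
    refineLoop fuel P Q Δup ε (k + 1) c = ⟨some Δ, s + 1⟩ := by
  ext1 <;> simp [refineLoop, h]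

lemma refineLoop_succ_of_none
    (h : refineRound fuel P Q Δup ε c = ⟨some none, s⟩)
    (hloop : refineLoop fuel P Q Δup ε k (2 * c) = ⟨some Δ, t⟩) :
    refineLoop fuel P Q Δup ε (k + 1) c = ⟨some Δ, s + 1 + t⟩ := by
  ext1
  · simp [refineLoop, h, hloop]
  · simp [refineLoop, h, hloop]
    ring

lemma exists_refineLoop_eq (hpos : 0 < frechetDist P Q) (hup : frechetDist P Q ≤ Δup)
    (hε : 0 < ε) (hε1 : ε ≤ 1) (m : ℕ) (hc : 1 ≤ c)
    (hPQ : P.IsPacked (2 ^ m * c) ∨ Q.IsPacked (2 ^ m * c)) :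
    ∃ (Δ : ℝ) (time : ℕ), IsRefinedBound P Q ε Δ ∧
      (time : ℝ) ≤ 245000 * (workUnit P Q ε * logFactor P Q Δup ε) * ((2 ^ (m + 1) - 1) * c) ∧
      ∀ᶠ fuel in atTop, ∀ k,
        refineLoop fuel P Q Δup ε (k + (m + 1)) c = ⟨some Δ, time⟩ := by
  induction m generalizing c with
  | zero =>
    obtain ⟨res, s, hround, hs, hres, hne⟩ := exists_refineRound_eq hpos hup hε hε1 hc
      fun Δ => fallibleDecider_steps_add_four_le P Q Δ hε hε1 hc
    obtain ⟨Δ, rfl⟩ := Option.ne_none_iff_exists'.mp (hne (by simpa using hPQ))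
    refine ⟨Δ, s + 1, hres Δ rfl, ?_, hround.mono fun fuel h k => refineLoop_succ_of_some h⟩
    push_cast
    linarith
  | succ m ih =>
    obtain ⟨res, s, hround, hs, hres, -⟩ := exists_refineRound_eq hpos hup hε hε1 hc
      fun Δ => fallibleDecider_steps_add_four_le P Q Δ hε hε1 hc
    have hsplit : ((2 : ℝ) ^ (m + 1 + 1) - 1) * c = (2 ^ (m + 1) - 1) * (2 * c) + c := by ring
    rw [hsplit, mul_add]
    cases res with
    | none =>
      obtain ⟨Δ, t, hΔ, ht, hloop⟩ := ih (c := 2 * c) (by linarith)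
        (by rwa [← mul_assoc, ← pow_succ])
      refine ⟨Δ, s + 1 + t, hΔ, ?_, ?_⟩
      · push_cast
        linarith
      · filter_upwards [hround, hloop] with fuel hround hloop k
        exact refineLoop_succ_of_none hround (hloop k)
    | some Δ =>
      refine ⟨Δ, s + 1, hres Δ rfl, ?_, hround.mono fun fuel h k => refineLoop_succ_of_some h⟩
      have hwork := workUnit_pos P Q hε
      have hlog := one_le_logFactor hpos hup hε
      have hpow : (0 : ℝ) ≤ 2 ^ (m + 1) - 1 := sub_nonneg.mpr (one_le_pow₀ one_le_two)
      have hrest : 0 ≤ 245000 * (workUnit P Q ε * logFactor P Q Δup ε) *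
          ((2 ^ (m + 1) - 1) * (2 * c)) := by positivity
      push_cast
      linarith

lemma refineUpperBoundReturns_of_eventually
    (h : ∀ᶠ fuel in atTop, ∀ j, refineLoop fuel P Q Δup ε (j + k) 1 = ⟨some Δ, t⟩) :
    RefineUpperBoundReturns P Q Δup ε Δ t := by
  refine eventually_atTop.mp ?_
  filter_upwards [h, eventually_ge_atTop k] with fuel hloop hfuel
  obtain ⟨j, hj⟩ := Nat.exists_eq_add_of_le' hfuel
  rw [refineUpperBound, ← hloop j, ← hj]

end Refine

end Frechet

theorem mainTheorem4 :
    ∃ C : ℝ, 0 < C ∧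
      ∀ (d : ℕ) (P Q : Frechet.Curve d) (c Δup ε : ℝ),
        1 ≤ c →
        (P.IsPacked c ∨ Q.IsPacked c) →
        0 < Frechet.frechetDist P Q →
        Frechet.frechetDist P Q ≤ Δup →
        0 < ε → ε ≤ 1 →
        ∃ (Δ : ℝ) (time : ℕ),
          Frechet.RefineUpperBoundReturns P Q Δup ε Δ time ∧
          Frechet.frechetDist P Q ≤ Δ ∧
          Δ < (1 + ε) ^ 2 * Frechet.frechetDist P Q ∧
          (time : ℝ) ≤ C * (c * ((P.size + Q.size : ℝ) / ε) *
            (1 + Real.log (1 + 1 / ε * Real.log (Δup / Frechet.frechetDist P Q)))) := by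
  refine ⟨980000, by norm_num, fun d P Q c Δup ε hc hPQ hpos hup hε hε1 => ?_⟩
  obtain ⟨n, hn, hn'⟩ := exists_nat_pow_near hc one_lt_two
  have hcn : c ≤ 2 ^ (n + 1) * 1 := by simpa using hn'.le
  obtain ⟨Δ, time, hΔ, htime, hloop⟩ := Frechet.exists_refineLoop_eq hpos hup hε hε1 (n + 1) le_rfl
    (hPQ.imp (Frechet.Curve.IsPacked.mono · hcn) (Frechet.Curve.IsPacked.mono · hcn))
  refine ⟨Δ, time, Frechet.refineUpperBoundReturns_of_eventually hloop, hΔ.1, hΔ.2, ?_⟩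
  have hwork := Frechet.workUnit_pos P Q hε
  have hlog := Frechet.one_le_logFactor hpos hup hε
  have hpow : ((2 : ℝ) ^ (n + 1 + 1) - 1) * 1 ≤ 4 * c := by
    rw [pow_succ, pow_succ]
    linarith
  calc (time : ℝ) ≤ _ := htime
    _ ≤ 245000 * (Frechet.workUnit P Q ε * Frechet.logFactor P Q Δup ε) * (4 * c) :=
      mul_le_mul_of_nonneg_left hpow (by positivity)
    _ = 980000 * (c * Frechet.workUnit P Q ε * Frechet.logFactor P Q Δup ε) := by ring
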